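/- Let $K$ be a hypergroup (in the sense of Dunkl, Jewett and Spector; not necessarily commutative) that carries a left Haar measure $\omega$. So $K$ is a locally compact Hausdorff space with a convolution of the unit point masses $\varepsilon_x$ $(x\in K)$, an identity $e$ and an involution $x\mapsto x^-$, and $\omega\ne 0$ is a Radon measure with $\varepsilon_x*\omega=\omega$ for all $x$. Let $\Delta$ be the modular function, given by $\omega*\varepsilon_{x^-}=\Delta(x)\,\omega$. Write $f(x*y)=\int f\,d(\varepsilon_x*\varepsilon_y)$ and $\tau_xf(y)=f(x*y)$, and let $\|\cdot\|_\infty$ be the essential supremum norm, where locally $\omega$-null sets are neglected. A function $f:K\to\mathbb C$ is of positive type if it is locally integrable and $\int f\cdot(g*g^*)\,d\omega\ge 0$ for all $g\in C_c(K)$, where $(g*h)(x)=\int g(x*y)\,h(y^-)\,d\omega(y)$ and $g^*(x)=\Delta(x^-)\,\overline{g(x^-)}$. The amalgam space $(L^1,\ell^\infty)(K)$ consists of the measurable functions $f$ such that $\sup_{x\in K}\|f\,\tau_x\mathbf 1_V\|_1<\infty$ for some relatively compact neighbourhood $V$ of $e$. Let $f\in(L^1,\ell^\infty)(K)$ be of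 positive type and let $U$ be a relatively compact neighbourhood of $e$. Then $$\|f\|_\infty\le\|f\,\mathbf 1_U\|_\infty .$$ In particular, for every $x\in K$, with $U_x=\{y\in K:\tau_x\mathbf 1_U(y)>0\}$, $$\|f\,\tau_x\mathbf 1_U\|_\infty\le\|f\,\mathbf 1_{U_x}\|_\infty\le\|f\,\mathbf 1_U\|_\infty .$$ -/

import Mathlib

open MeasureTheory
open scoped ENNReal ComplexOrder

/-- A hypergroup (in the sense of Dunkl, Jewett and Spector, as in the book of Bloom and Heyer),
given by the convolutions `conv x y = ε_x * ε_y` of the unit point masses. It is meant for a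
locally compact Hausdorff space `K` with its Borel σ-algebra. The convolution of bounded Radon
measures is the bilinear, weakly continuous extension of `conv`, so that its associativity is
associativity on point masses, tested against `C_c(K)`. -/
class Hypergroup (K : Type*) [TopologicalSpace K] [MeasurableSpace K] [BorelSpace K] where
  /-- `ε_x * ε_y`, a probability measure -/
  conv : K → K → ProbabilityMeasure K
  /-- the identity element -/
  e : K
  /-- the involution `x ↦ x⁻` -/
  inv : K → K
  /-- `ε_x * ε_y` is a Radon measure -/
  regular_conv : ∀ x y, (conv x y : Measure K).Regular
  isCompact_support_conv : ∀ x y, IsCompact (conv x y : Measure K).support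
  /-- `(x, y) ↦ ε_x * ε_y` is continuous for the weak topology -/
  continuous_conv : Continuous fun p : K × K => conv p.1 p.2
  /-- `(ε_x * ε_y) * ε_z = ε_x * (ε_y * ε_z)` -/
  conv_assoc : ∀ (x y z : K) (φ : K → ℝ), Continuous φ → HasCompactSupport φ →
    ∫ w, (∫ t, φ t ∂(conv w z : Measure K)) ∂(conv x y : Measure K) =
      ∫ w, (∫ t, φ t ∂(conv x w : Measure K)) ∂(conv y z : Measure K)
  /-- `(x, y) ↦ supp (ε_x * ε_y)` is continuous for the Michael (Vietoris) topology on the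
  nonempty compact sets, which is the subspace topology from `TopologicalSpace.vietoris K` -/
  continuous_support_conv :
    @Continuous (K × K) (Set K) _ (TopologicalSpace.vietoris K)
      fun p => (conv p.1 p.2 : Measure K).support
  e_conv : ∀ x, (conv e x : Measure K) = Measure.dirac x
  conv_e : ∀ x, (conv x e : Measure K) = Measure.dirac x
  continuous_inv : Continuous inv
  inv_inv : ∀ x, inv (inv x) = x
  /-- `(ε_x * ε_y)⁻ = ε_{y⁻} * ε_{x⁻}` -/
  map_inv_conv : ∀ x y,
    (conv x y : Measure K).map inv = (conv (inv y) (inv x) : Measure K)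
  e_mem_support_conv_iff : ∀ x y, e ∈ (conv x y : Measure K).support ↔ x = inv y

namespace Hypergroup

variable {K : Type*} [TopologicalSpace K] [MeasurableSpace K] [BorelSpace K] [Hypergroup K]

/-- `f (x * y) = ∫ f d(ε_x * ε_y)`. -/
noncomputable def evalMul {E : Type*} [NormedAddCommGroup E] [NormedSpace ℝ E]
    (f : K → E) (x y : K) : E :=
  ∫ z, f z ∂(conv x y : Measure K)

/-- The translate `τ_x f`, where `τ_x f (y) = f (x * y)`. -/
noncomputable def translate {E : Type*} [NormedAddCommGroup E] [NormedSpace ℝ E]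
    (x : K) (f : K → E) (y : K) : E :=
  evalMul f x y

/-- The indicator function `1_U`. -/
noncomputable def ind (U : Set K) : K → ℝ :=
  U.indicator fun _ => 1

/-- A left Haar measure: a nonzero Radon measure `ω` with `ε_x * ω = ω` for all `x`. -/
structure IsLeftHaar (ω : Measure K) : Prop where
  regular : ω.Regular
  ne_zero : ω ≠ 0
  integral_translate : ∀ (x : K) (φ : K → ℝ), Continuous φ → HasCompactSupport φ →
    ∫ y, evalMul φ x y ∂ω = ∫ y, φ y ∂ω

/-- The modular function: `Δ x` is the constant with `ω * ε_{x⁻} = Δ(x) ω`. -/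
noncomputable def modular (ω : Measure K) (x : K) : ℝ :=
  Classical.epsilon fun c : ℝ => ∀ φ : K → ℝ, Continuous φ → HasCompactSupport φ →
    ∫ y, evalMul φ y (inv x) ∂ω = c * ∫ y, φ y ∂ω

/-- `g^* (x) = Δ(x⁻) conj (g (x⁻))`. -/
noncomputable def adj (ω : Measure K) (g : K → ℂ) (x : K) : ℂ :=
  (modular ω (inv x) : ℂ) * star (g (inv x))

/-- The convolution `(g * h)(x) = ∫ g(x * y) h(y⁻) dω(y)` of functions. -/
noncomputable def convFun (ω : Measure K) (g h : K → ℂ) (x : K) : ℂ :=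
  ∫ y, evalMul g x y * h (inv y) ∂ω

/-- `f` is locally integrable and `∫ f · (g * g^*) dω ≥ 0` for every `g ∈ C_c(K)`. -/
def IsPositiveType (ω : Measure K) (f : K → ℂ) : Prop :=
  LocallyIntegrable f ω ∧ ∀ g : K → ℂ, Continuous g → HasCompactSupport g →
    0 ≤ ∫ x, f x * convFun ω g (adj ω g) x ∂ω

/-- `‖f‖_{1,∞,U} = sup_x ‖f · τ_x 1_U‖_1`. -/
noncomputable def amalgamNorm (ω : Measure K) (U : Set K) (f : K → ℂ) : ℝ≥0∞ :=
  ⨆ x : K, eLpNorm (fun y => f y * ((translate x (ind U) y : ℝ) : ℂ)) 1 ω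

/-- The amalgam space `(L^1, ℓ^∞)(K)`. As usual for Radon measures on spaces that need not be
σ-compact, `f` is measurable if it is so, up to null sets, on every compact set. -/
def MemAmalgam (ω : Measure K) (f : K → ℂ) : Prop :=
  (∀ C : Set K, IsCompact C → AEStronglyMeasurable f (ω.restrict C)) ∧
    ∃ U : Set K, U ∈ nhds (e : K) ∧ IsCompact (closure U) ∧ MeasurableSet U ∧
      amalgamNorm ω U f < ∞

/-- The norm `‖f‖_∞`, that is, the least `M` such that `|f| ≤ M` holds `ω`-almost everywhere on
every compact set (the essential supremum with respect to locally null sets; this is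
the ordinary essential supremum if `K` is σ-compact). -/
noncomputable def supNorm (ω : Measure K) (f : K → ℂ) : ℝ≥0∞ :=
  ⨆ (C : Set K) (_ : IsCompact C), eLpNorm f ∞ (ω.restrict C)

end Hypergroup

open Filter Topology Set

set_option linter.unusedSectionVars false

namespace Hypergroup

/-! Write `L φ = ∫ f φ dω` and let `M > 0` bound `|f|` on `U`. Positive type makes `(g, h) ↦ L (g *
h^*)` a positive semidefinite Hermitian form, so Cauchy–Schwarz holds. Testing `h` against an
approximate identity `κ = k^*` so concentrated at `e` that `κ * κ^*` lives in `U` gives `|L (κ *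
κ^*)| ≤ M` and `h * κ^* → h`, hence `|L h|² ≤ M |L (h * h^*)|`
(`IsPositiveType.sq_norm_pairing_le`).

For `h = h^*` this can be iterated: `|L h|^(2^n) ≤ M^(2^n - 1) |L h_n|`, where `h_n` is the `2^n`-th
convolution power. Boundedness of `f` is not available to estimate `L h_n`; the amalgam condition
replaces it. It bounds the `|f| ω`-integrals of all left translates of `|h|` by one constant `C`.
Convolution with `g` on the left averages translates, so it multiplies such a bound by at most
`‖g‖₁` (`TranslateBound.corr`). Thus `|L h_n| ≤ C ‖h‖₁^(2^n - 1)`, and `2^n`-th roots remove `C`: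
`|L h| ≤ M ‖h‖₁`. One more use of the quadratic inequality, with `h * h^*` on the right, extends
this to every test function `h`, and duality between `L¹` and `L^∞` yields `|f| ≤ M` locally almost
everywhere.

The rest is harmonic analysis on `K` derived from the axioms: calculus of supports, left translation
by `x⁻` as adjoint of that by `x`, and the modular function. Everything is tested on `C_c(K)`, where
Fubini needs no σ-finiteness. -/

/-- A continuous function equal to `1` on a given compact set. -/
theorem exists_cutoff {K : Type*} [TopologicalSpace K] [T2Space K] [LocallyCompactSpace K]
    {C : Set K} (hC : IsCompact C) {O : Set K} (hO : IsOpen O) (hCO : C ⊆ O) :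
    ∃ χ : K → ℝ, Continuous χ ∧ HasCompactSupport χ ∧ (∀ z ∈ C, χ z = 1) ∧
      (∀ z, 0 ≤ χ z) ∧ (∀ z, χ z ≤ 1) ∧ tsupport χ ⊆ O := by
  obtain ⟨L, hL, hCL, hLO⟩ := exists_compact_between hC hO hCO
  obtain ⟨χ, h1, h0, hc, hm⟩ := exists_continuous_one_zero_of_isCompact hC
    (isOpen_interior (s := L)).isClosed_compl
    (Set.disjoint_left.2 fun z hz hz' => hz' (hCL hz))
  refine ⟨χ, χ.continuous, hc, fun z hz => h1 hz, fun z => (hm z).1, fun z => (hm z).2, ?_⟩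
  refine Set.Subset.trans ?_ hLO
  refine closure_minimal ?_ hL.isClosed
  intro z hz
  by_contra hz'
  exact hz (h0 (fun h => hz' (interior_subset h)))

/-! ### Supports of the convolutions of point masses. -/

section Support

variable {K : Type*} [TopologicalSpace K] [MeasurableSpace K] [BorelSpace K] [Hypergroup K]

/-- The support of `ε_x * ε_y`. -/
def supp (x y : K) : Set K := (conv x y : Measure K).support

theorem isCompact_supp (x y : K) : IsCompact (supp x y) := isCompact_support_conv x y

theorem ae_mem_supp (x y : K) : ∀ᵐ z ∂(conv x y : Measure K), z ∈ supp x y := by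
  have := regular_conv x y
  exact Measure.support_mem_ae_of_regular

theorem evalMul_congr {f g : K → ℝ} {x y : K} (h : ∀ z ∈ supp x y, f z = g z) :
    evalMul f x y = evalMul g x y :=
  integral_congr_ae ((ae_mem_supp x y).mono h)

theorem evalMul_const (c : ℝ) (x y : K) : evalMul (fun _ => c) x y = c := by
  simp [evalMul]

theorem supp_nonempty (x y : K) : (supp x y).Nonempty := (ae_mem_supp x y).exists

/-- This is the upper half of Vietoris continuity, and the source of all compactness arguments on
supports. -/
theorem eventually_supp_subset {O : Set K} (hO : IsOpen O) {x y : K} (h : supp x y ⊆ O) :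
    ∀ᶠ p : K × K in 𝓝 (x, y), supp p.1 p.2 ⊆ O := by
  let := TopologicalSpace.vietoris K
  have h1 : IsOpen (𝒫 O) := hO.powerset_vietoris
  exact (h1.preimage (continuous_support_conv (K := K))).mem_nhds h

theorem exists_isCompact_supp_subset [LocallyCompactSpace K] {A : Set (K × K)}
    (hA : IsCompact A) : ∃ C, IsCompact C ∧ ∀ p ∈ A, supp p.1 p.2 ⊆ C := by
  refine hA.induction_on (p := fun A => ∃ C, IsCompact C ∧ ∀ p ∈ A, supp p.1 p.2 ⊆ C)
    ⟨∅, isCompact_empty, by simp⟩ ?_ ?_ ?_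
  · rintro s t hst ⟨C, hC, h⟩
    exact ⟨C, hC, fun p hp => h p (hst hp)⟩
  · rintro s t ⟨C, hC, h⟩ ⟨C', hC', h'⟩
    refine ⟨C ∪ C', hC.union hC', ?_⟩
    rintro p (hp | hp)
    · exact (h p hp).trans subset_union_left
    · exact (h' p hp).trans subset_union_right
  · rintro ⟨x, y⟩ -
    obtain ⟨C, hC, h⟩ := exists_compact_superset (isCompact_supp x y)
    exact ⟨_, mem_nhdsWithin_of_mem_nhds (eventually_supp_subset isOpen_interior h), C, hC,
      fun p hp => Set.Subset.trans hp interior_subset⟩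

theorem supp_e_left [T2Space K] (x : K) : supp e x = {x} := by
  unfold supp
  rw [e_conv]
  apply Set.Subset.antisymm
  · apply Measure.support_subset_of_isClosed isClosed_singleton
    simp
  · rintro _ rfl
    rw [Measure.mem_support_iff_forall]
    intro U hU
    rw [Measure.dirac_apply_of_mem (mem_of_mem_nhds hU)]
    simp

theorem supp_e_right [T2Space K] (x : K) : supp x e = {x} := by
  have := supp_e_left x
  unfold supp at *
  rwa [conv_e, ← e_conv]

theorem evalMul_e_left [T2Space K] {E : Type*} [NormedAddCommGroup E] [NormedSpace ℝ E]
    [CompleteSpace E] (f : K → E) (x : K) : evalMul f e x = f x := by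
  rw [evalMul, e_conv, integral_dirac]

theorem evalMul_inv (φ : K → ℝ) (x y : K) :
    evalMul φ (inv x) (inv y) = evalMul (fun z => φ (inv z)) y x := by
  unfold evalMul
  rw [← map_inv_conv]
  let i : K ≃ₜ K := ⟨⟨inv, inv, inv_inv, inv_inv⟩, continuous_inv, continuous_inv⟩
  exact i.measurableEmbedding.integral_map φ

theorem evalMul_nonneg {φ : K → ℝ} {x y : K} (h : ∀ z ∈ supp x y, 0 ≤ φ z) :
    0 ≤ evalMul φ x y :=
  integral_nonneg_of_ae ((ae_mem_supp x y).mono h)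

theorem abs_evalMul_le (φ : K → ℝ) (x y : K) :
    |evalMul φ x y| ≤ evalMul (fun z => |φ z|) x y :=
  abs_integral_le_integral_abs

theorem evalMul_const_mul (c : ℝ) (φ : K → ℝ) (x y : K) :
    evalMul (fun z => c * φ z) x y = c * evalMul φ x y :=
  integral_const_mul c φ

theorem evalMul_eq_zero {φ : K → ℝ} {x y : K} (h : ∀ z ∈ supp x y, φ z = 0) :
    evalMul φ x y = 0 := by
  rw [evalMul_congr h, evalMul_const]

theorem mem_supp_inv {x y z : K} (h : z ∈ supp x y) : inv z ∈ supp (inv y) (inv x) := by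
  unfold supp at *
  rw [← map_inv_conv]
  rw [Measure.mem_support_iff_forall] at *
  intro U hU
  have := h _ ((continuous_inv (K := K)).continuousAt.preimage_mem_nhds hU)
  exact this.trans_le (Measure.le_map_apply (continuous_inv (K := K)).aemeasurable U)

end Support

/-! ### Continuity of `φ (x * y)`, associativity, and rotation of supports. -/

section Compact

variable {K : Type*} [TopologicalSpace K] [T2Space K] [LocallyCompactSpace K]
  [MeasurableSpace K] [BorelSpace K] [Hypergroup K]

theorem integrable_conv {φ : K → ℝ} (hφ : Continuous φ) (x y : K) :
    Integrable φ (conv x y : Measure K) := by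
  have h : (conv x y : Measure K).restrict (supp x y) = (conv x y : Measure K) :=
    Measure.restrict_eq_self_of_ae_mem (ae_mem_supp x y)
  rw [← h]
  exact hφ.continuousOn.integrableOn_compact (isCompact_supp x y)

theorem evalMul_mono {φ ψ : K → ℝ} (hφ : Continuous φ) (hψ : Continuous ψ) {x y : K}
    (h : ∀ z ∈ supp x y, φ z ≤ ψ z) : evalMul φ x y ≤ evalMul ψ x y :=
  integral_mono_ae (integrable_conv hφ x y) (integrable_conv hψ x y)
    ((ae_mem_supp x y).mono h)

theorem abs_evalMul_sub_le {φ : K → ℝ} (hφ : Continuous φ) {x y : K} {a ε : ℝ}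
    (h : ∀ z ∈ supp x y, |φ z - a| ≤ ε) : |evalMul φ x y - a| ≤ ε := by
  have h1 : evalMul φ x y - a = evalMul (fun z => φ z - a) x y := by
    unfold evalMul
    rw [integral_sub (integrable_conv hφ x y) (integrable_const a)]
    simp
  rw [h1]
  refine (abs_evalMul_le _ x y).trans ?_
  rw [← evalMul_const ε x y]
  exact evalMul_mono (by fun_prop) (by fun_prop) h

theorem evalMul_pos {φ : K → ℝ} (hφ : Continuous φ) (h0 : ∀ z, 0 ≤ φ z) {x y z : K}
    (hz : z ∈ supp x y) (hpos : 0 < φ z) : 0 < evalMul φ x y := by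
  unfold evalMul
  rw [integral_pos_iff_support_of_nonneg h0 (integrable_conv hφ x y)]
  exact (Measure.mem_support_iff_forall z).1 hz _ ((hφ.isOpen_support).mem_nhds hpos.ne')

/-- Continuity of integrals against `ε_x * ε_y` of functions depending on a parameter. -/
theorem continuous_integral_conv {Y : Type*} [TopologicalSpace Y] {F : K × Y → ℝ}
    (hF : Continuous F) :
    Continuous fun q : (K × K) × Y => evalMul (fun t => F (t, q.2)) q.1.1 q.1.2 := by
  rw [continuous_iff_continuousAt]
  rintro ⟨⟨x, y⟩, u⟩
  rw [ContinuousAt, Metric.tendsto_nhds]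
  intro ε hε
  -- Nearby supports stay in the compact `C`. There the cutoff makes weak convergence applicable,
  -- and the dependence on the parameter is uniform.
  obtain ⟨C, hC, hsC⟩ := exists_compact_superset (isCompact_supp x y)
  have hev := eventually_supp_subset isOpen_interior hsC
  obtain ⟨χ, χc, χs, χ1, -, -, -⟩ := exists_cutoff hC isOpen_univ (subset_univ C)
  have hg : Continuous fun t => χ t * F (t, u) := by fun_prop
  have hgs : HasCompactSupport fun t => χ t * F (t, u) := χs.mul_right
  let g : BoundedContinuousFunction K ℝ :=
    BoundedContinuousFunction.ofNormedAddCommGroup _ hg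
      (hgs.exists_bound_of_continuous hg).choose (hgs.exists_bound_of_continuous hg).choose_spec
  have hw : Tendsto (fun p : K × K => evalMul (fun t => χ t * F (t, u)) p.1 p.2) (𝓝 (x, y))
      (𝓝 (evalMul (fun t => χ t * F (t, u)) x y)) :=
    ProbabilityMeasure.tendsto_iff_forall_integral_tendsto.1
      ((continuous_conv (K := K)).tendsto (x, y)) g
  have hw2 := Metric.tendsto_nhds.1 hw (ε / 2) (half_pos hε)
  have hu : ∀ᶠ v in 𝓝 u, ∀ t ∈ C, |F (t, v) - F (t, u)| < ε / 2 := by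
    refine hC.eventually_forall_of_forall_eventually fun t _ => ?_
    have hc : Continuous fun q : Y × K => |F (q.2, q.1) - F (q.2, u)| := by fun_prop
    exact hc.continuousAt.eventually_lt continuousAt_const (by simpa using half_pos hε)
  rw [nhds_prod_eq]
  filter_upwards [(hev.and hw2).prod_mk hu] with ⟨⟨a, b⟩, v⟩ ⟨⟨h1, h2⟩, h3⟩
  simp only at h1 h2 h3 ⊢
  have e1 : ∀ {a b : K}, supp a b ⊆ interior C →
      evalMul (fun t => χ t * F (t, u)) a b = evalMul (fun t => F (t, u)) a b := fun h =>
    evalMul_congr fun z hz => by rw [χ1 z (interior_subset (h hz)), one_mul]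
  rw [e1 h1, e1 hsC] at h2
  have h4 : |evalMul (fun t => F (t, v)) a b - evalMul (fun t => F (t, u)) a b| ≤ ε / 2 := by
    have : evalMul (fun t => F (t, v)) a b - evalMul (fun t => F (t, u)) a b
        = evalMul (fun t => F (t, v) - F (t, u)) a b :=
      (integral_sub (integrable_conv (by fun_prop) a b) (integrable_conv (by fun_prop) a b)).symm
    rw [this, ← sub_zero (evalMul _ a b)]
    refine abs_evalMul_sub_le (by fun_prop) fun z hz => ?_
    rw [sub_zero]
    exact (h3 z (interior_subset (h1 hz))).le
  rw [Real.dist_eq] at *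
  have := abs_add_le (evalMul (fun t => F (t, v)) a b - evalMul (fun t => F (t, u)) a b)
    (evalMul (fun t => F (t, u)) a b - evalMul (fun t => F (t, u)) x y)
  rw [sub_add_sub_cancel] at this
  linarith

theorem continuous_evalMul {φ : K → ℝ} (hφ : Continuous φ) :
    Continuous fun p : K × K => evalMul φ p.1 p.2 := by
  have : Continuous fun q : K × Unit => φ q.1 := by fun_prop
  exact (continuous_integral_conv this).comp (f := fun p : K × K => (p, ())) (by fun_prop)

@[fun_prop]
theorem _root_.Continuous.evalMul {X : Type*} [TopologicalSpace X] {φ : K → ℝ}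
    (hφ : Continuous φ) {a b : X → K} (ha : Continuous a) (hb : Continuous b) :
    Continuous fun t => evalMul φ (a t) (b t) :=
  (continuous_evalMul hφ).comp (ha.prodMk hb)

/-- Associativity for all continuous functions. -/
theorem evalMul_assoc {φ : K → ℝ} (hφ : Continuous φ) (x y z : K) :
    evalMul (fun w => evalMul φ w z) x y = evalMul (fun w => evalMul φ x w) y z := by
  obtain ⟨C, hC, h1⟩ := exists_isCompact_supp_subset
    ((isCompact_supp x y).prod (isCompact_singleton (x := z)))
  obtain ⟨D, hD, h2⟩ := exists_isCompact_supp_subset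
    ((isCompact_singleton (x := x)).prod (isCompact_supp y z))
  obtain ⟨χ, χc, χs, χ1, -, -, -⟩ := exists_cutoff (hC.union hD) isOpen_univ (subset_univ _)
  have := conv_assoc x y z (fun t => χ t * φ t) (by fun_prop) χs.mul_right
  have e1 : evalMul (fun w => evalMul φ w z) x y
      = evalMul (fun w => evalMul (fun t => χ t * φ t) w z) x y :=
    evalMul_congr fun w hw => evalMul_congr fun t ht => by
      rw [χ1 t (Or.inl (h1 (w, z) ⟨hw, rfl⟩ ht)), one_mul]
  have e2 : evalMul (fun w => evalMul φ x w) y z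
      = evalMul (fun w => evalMul (fun t => χ t * φ t) x w) y z :=
    evalMul_congr fun w hw => evalMul_congr fun t ht => by
      rw [χ1 t (Or.inr (h2 (x, w) ⟨rfl, hw⟩ ht)), one_mul]
  rw [e1, e2]
  exact this

/-- Otherwise `e` lies in no `supp w y` with `w ∈ supp (inv z) x`, and by compactness a whole
neighbourhood `O` of `e` misses these sets. Then `(z⁻ * x) * y` gives `O` no mass. But `z⁻ * (x *
y)` charges `O`, since `z ∈ supp x y` and `e ∈ supp (inv z) z`; this contradicts associativity. -/
theorem mem_supp_rotate {x y z : K} (h : z ∈ supp x y) : inv y ∈ supp (inv z) x := by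
  by_contra hy
  have key : ∃ O ∈ 𝓝 (e : K), ∀ w ∈ supp (inv z) x, Disjoint (supp w y) O := by
    refine (isCompact_supp (inv z) x).induction_on
      (p := fun A => ∃ O ∈ 𝓝 (e : K), ∀ w ∈ A, Disjoint (supp w y) O)
      ⟨univ, univ_mem, by simp⟩ ?_ ?_ ?_
    · rintro s t hst ⟨O, hO, h⟩
      exact ⟨O, hO, fun w hw => h w (hst hw)⟩
    · rintro s t ⟨O, hO, h⟩ ⟨O', hO', h'⟩
      refine ⟨O ∩ O', inter_mem hO hO', ?_⟩
      rintro w (hw | hw)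
      · exact (h w hw).mono_right inter_subset_left
      · exact (h' w hw).mono_right inter_subset_right
    · intro w hw
      have he : (e : K) ∉ supp w y := by
        intro he
        exact hy (((e_mem_support_conv_iff w y).1 he) ▸ hw)
      obtain ⟨u, v, hu, hv, hsu, hev, huv⟩ := SeparatedNhds.of_isCompact_isCompact
        (isCompact_supp w y) (isCompact_singleton (x := (e : K))) (by simpa using he)
      have h1 := (eventually_supp_subset hu hsu)
      rw [nhds_prod_eq] at h1
      have h2 : ∀ᶠ a in 𝓝 w, supp a y ⊆ u := h1.curry.mono fun a ha => ha.self_of_nhds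
      exact ⟨_, mem_nhdsWithin_of_mem_nhds h2, v, hv.mem_nhds (hev rfl),
        fun a ha => huv.mono_left ha⟩
  obtain ⟨O, hO, hd⟩ := key
  obtain ⟨φ, φc, -, φ1, φ0, -, φO⟩ := exists_cutoff (isCompact_singleton (x := (e : K)))
    isOpen_interior (singleton_subset_iff.2 (mem_interior_iff_mem_nhds.2 hO))
  have h0 : evalMul (fun w => evalMul φ w y) (inv z) x = 0 := by
    rw [← evalMul_const 0 (inv z) x]
    refine evalMul_congr fun w hw => ?_
    rw [← evalMul_const 0 w y]
    refine evalMul_congr fun t ht => ?_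
    by_contra hne
    exact Set.disjoint_left.1 (hd w hw) ht (interior_subset (φO (subset_tsupport _ hne)))
  rw [evalMul_assoc φc] at h0
  have he : (e : K) ∈ supp (inv z) z := (e_mem_support_conv_iff _ _).2 rfl
  have h1 := evalMul_pos (φ := fun w => evalMul φ (inv z) w) (by fun_prop)
    (fun w => evalMul_nonneg fun t _ => φ0 t) h
    (evalMul_pos φc φ0 he (by rw [φ1 e rfl]; exact one_pos))
  exact h1.ne' h0

theorem mem_supp_right {x y z : K} (h : z ∈ supp x y) : y ∈ supp (inv x) z := by
  simpa only [inv_inv] using mem_supp_inv (mem_supp_rotate h)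

theorem mem_supp_left {x y z : K} (h : z ∈ supp x y) : x ∈ supp z (inv y) := by
  simpa only [inv_inv] using mem_supp_inv (mem_supp_right (mem_supp_inv h))

end Compact

/-! ### Test functions. -/

section TestFunctions

/-- The real-valued continuous functions with compact support. -/
structure IsTest {K : Type*} [TopologicalSpace K] (φ : K → ℝ) : Prop where
  continuous : Continuous φ
  hasCompactSupport : HasCompactSupport φ

variable {K : Type*} [TopologicalSpace K]

theorem IsTest.abs {φ : K → ℝ} (h : IsTest φ) : IsTest fun z => |φ z| :=
  ⟨h.1.abs, h.2.comp_left abs_zero⟩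

theorem IsTest.mul_left {φ ψ : K → ℝ} (h : IsTest φ) (hψ : Continuous ψ) :
    IsTest fun z => ψ z * φ z :=
  ⟨hψ.mul h.1, h.2.mul_left⟩

theorem IsTest.mul_right {φ ψ : K → ℝ} (h : IsTest φ) (hψ : Continuous ψ) :
    IsTest fun z => φ z * ψ z :=
  ⟨h.1.mul hψ, h.2.mul_right⟩

theorem IsTest.add {φ ψ : K → ℝ} (h : IsTest φ) (h' : IsTest ψ) : IsTest fun z => φ z + ψ z :=
  ⟨h.1.add h'.1, h.2.add h'.2⟩

theorem IsTest.sub {φ ψ : K → ℝ} (h : IsTest φ) (h' : IsTest ψ) : IsTest fun z => φ z - ψ z :=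
  ⟨h.1.sub h'.1, h.2.sub h'.2⟩

theorem IsTest.integrable [MeasurableSpace K] [BorelSpace K] {φ : K → ℝ} (h : IsTest φ)
    (μ : Measure K) [IsFiniteMeasureOnCompacts μ] : Integrable φ μ :=
  h.1.integrable_of_hasCompactSupport h.2

theorem IsTest.of_isCompact [T2Space K] {φ : K → ℝ} (h : Continuous φ) {C : Set K}
    (hC : IsCompact C) (h0 : ∀ z, z ∉ C → φ z = 0) : IsTest φ :=
  ⟨h, HasCompactSupport.intro hC h0⟩

theorem IsTest.eq_zero {φ : K → ℝ} {z : K} (h : z ∉ tsupport φ) : φ z = 0 :=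
  image_eq_zero_of_notMem_tsupport h

end TestFunctions

/-! ### Fubini for continuous integrands of compact support. -/

section Fubini

theorem integral_integral_swap_of_isCompact {X Y : Type*} [TopologicalSpace X] [T2Space X]
    [MeasurableSpace X] [OpensMeasurableSpace X] [TopologicalSpace Y] [T2Space Y]
    [MeasurableSpace Y] [OpensMeasurableSpace Y] (μ : Measure X) (ν : Measure Y)
    [IsFiniteMeasureOnCompacts μ] [IsFiniteMeasureOnCompacts ν] {F : X → Y → ℝ}
    (hF : Continuous fun p : X × Y => F p.1 p.2) {A : Set X} {B : Set Y} (hA : IsCompact A)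
    (hB : IsCompact B) (h0 : ∀ x y, F x y ≠ 0 → x ∈ A ∧ y ∈ B) :
    ∫ x, ∫ y, F x y ∂ν ∂μ = ∫ y, ∫ x, F x y ∂μ ∂ν := by
  refine integral_integral_swap_of_hasCompactSupport hF
    (HasCompactSupport.intro (hA.prod hB) fun p hp => ?_)
  by_contra h
  exact hp (h0 p.1 p.2 h)

theorem continuous_integral_of_locally_compact_support {X Y : Type*} [TopologicalSpace X]
    [TopologicalSpace Y] [MeasurableSpace Y] [OpensMeasurableSpace Y] (μ : Measure Y)
    [IsFiniteMeasureOnCompacts μ] {F : X → Y → ℝ}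
    (hF : Continuous fun p : X × Y => F p.1 p.2)
    (h0 : ∀ x₀, ∃ N ∈ 𝓝 x₀, ∃ C, IsCompact C ∧ ∀ x ∈ N, ∀ y, F x y ≠ 0 → y ∈ C) :
    Continuous fun x => ∫ y, F x y ∂μ := by
  rw [continuous_iff_continuousAt]
  intro x₀
  obtain ⟨N, hN, C, hC, h⟩ := h0 x₀
  refine (continuousOn_integral_of_compact_support hC hF.continuousOn ?_).continuousAt hN
  intro p x hp hx
  by_contra h'
  exact hx (h p hp x h')

variable {K : Type*} [TopologicalSpace K] [T2Space K] [LocallyCompactSpace K]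
  [MeasurableSpace K] [BorelSpace K] [Hypergroup K]

theorem evalMul_integral {Y : Type*} [TopologicalSpace Y] [T2Space Y] [LocallyCompactSpace Y]
    [MeasurableSpace Y] [BorelSpace Y] (μ : Measure Y)
    [IsFiniteMeasureOnCompacts μ] {F : K → Y → ℝ} (hF : Continuous fun p : K × Y => F p.1 p.2)
    {x y : K} {C : Set Y} (hC : IsCompact C) (h0 : ∀ t ∈ supp x y, ∀ z, F t z ≠ 0 → z ∈ C) :
    evalMul (fun t => ∫ z, F t z ∂μ) x y = ∫ z, evalMul (fun t => F t z) x y ∂μ := by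
  -- Multiplying by cutoffs `χ` and `θ` leaves the integrand unchanged on `supp x y` and makes it
  -- compactly supported in both variables.
  obtain ⟨χ, χc, χs, χ1, -, -, -⟩ := exists_cutoff (isCompact_supp x y) isOpen_univ
    (subset_univ _)
  obtain ⟨L, hL, hCL⟩ := exists_compact_superset hC
  obtain ⟨θ, h1, hθ, θs, hm⟩ := exists_continuous_one_zero_of_isCompact hC isClosed_empty
    (disjoint_empty C)
  have e : ∀ t ∈ supp x y, ∀ z, F t z = χ t * θ z * F t z := by
    intro t ht z
    by_cases hz : F t z = 0
    · simp [hz]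
    · rw [χ1 t ht, h1 (h0 t ht z hz)]; simp
  have e1 : evalMul (fun t => ∫ z, F t z ∂μ) x y
      = evalMul (fun t => ∫ z, χ t * θ z * F t z ∂μ) x y :=
    evalMul_congr fun t ht => integral_congr_ae (.of_forall fun z => e t ht z)
  have e2 : ∀ z, evalMul (fun t => F t z) x y = evalMul (fun t => χ t * θ z * F t z) x y :=
    fun z => evalMul_congr fun t ht => e t ht z
  simp_rw [e1, e2]
  refine integral_integral_swap_of_isCompact _ μ (by fun_prop) χs θs fun t z h => ⟨?_, ?_⟩
  · exact subset_tsupport _ fun h' => h (by simp [h'])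
  · exact subset_tsupport _ fun h' => h (by simp [h'])

end Fubini

/-! ### Translates of test functions. -/

section Translates

variable {K : Type*} [TopologicalSpace K] [T2Space K] [LocallyCompactSpace K]
  [MeasurableSpace K] [BorelSpace K] [Hypergroup K]

theorem exists_mem_supp_of_evalMul_ne_zero {φ : K → ℝ} {x y : K} (h : evalMul φ x y ≠ 0) :
    ∃ z ∈ supp x y, φ z ≠ 0 := by
  by_contra! h'
  exact h (evalMul_eq_zero h')

theorem exists_isCompact_right {A B : Set K} (hA : IsCompact A) (hB : IsCompact B) :
    ∃ C, IsCompact C ∧ ∀ x ∈ A, ∀ y, ∀ z ∈ supp x y, z ∈ B → y ∈ C := by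
  obtain ⟨C, hC, h⟩ := exists_isCompact_supp_subset ((hA.image continuous_inv).prod hB)
  exact ⟨C, hC, fun x hx y z hz hzB => h (inv x, z) ⟨mem_image_of_mem _ hx, hzB⟩
    (mem_supp_right hz)⟩

theorem exists_isCompact_left {A B : Set K} (hA : IsCompact A) (hB : IsCompact B) :
    ∃ C, IsCompact C ∧ ∀ y ∈ A, ∀ x, ∀ z ∈ supp x y, z ∈ B → x ∈ C := by
  obtain ⟨C, hC, h⟩ := exists_isCompact_supp_subset (hB.prod (hA.image continuous_inv))
  exact ⟨C, hC, fun y hy x z hz hzB => h (z, inv y) ⟨hzB, mem_image_of_mem _ hy⟩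
    (mem_supp_left hz)⟩

theorem exists_isCompact_evalMul_right {φ : K → ℝ} (hφ : IsTest φ) {A : Set K}
    (hA : IsCompact A) :
    ∃ C, IsCompact C ∧ ∀ x ∈ A, ∀ y, evalMul φ x y ≠ 0 → y ∈ C := by
  obtain ⟨C, hC, h⟩ := exists_isCompact_right hA hφ.2
  refine ⟨C, hC, fun x hx y hxy => ?_⟩
  obtain ⟨z, hz, hz'⟩ := exists_mem_supp_of_evalMul_ne_zero hxy
  exact h x hx y z hz (subset_tsupport _ hz')

theorem exists_isCompact_evalMul_left {φ : K → ℝ} (hφ : IsTest φ) {A : Set K}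
    (hA : IsCompact A) :
    ∃ C, IsCompact C ∧ ∀ y ∈ A, ∀ x, evalMul φ x y ≠ 0 → x ∈ C := by
  obtain ⟨C, hC, h⟩ := exists_isCompact_left hA hφ.2
  refine ⟨C, hC, fun x hx y hxy => ?_⟩
  obtain ⟨z, hz, hz'⟩ := exists_mem_supp_of_evalMul_ne_zero hxy
  exact h x hx y z hz (subset_tsupport _ hz')

theorem IsTest.evalMul_right {φ : K → ℝ} (hφ : IsTest φ) (x : K) :
    IsTest fun y => evalMul φ x y := by
  obtain ⟨C, hC, h⟩ := exists_isCompact_evalMul_right hφ (isCompact_singleton (x := x))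
  exact .of_isCompact (hφ.1.evalMul continuous_const continuous_id) hC fun y hy => by
    by_contra h'
    exact hy (h x rfl y h')

theorem IsTest.evalMul_left {φ : K → ℝ} (hφ : IsTest φ) (y : K) :
    IsTest fun x => evalMul φ x y := by
  obtain ⟨C, hC, h⟩ := exists_isCompact_evalMul_left hφ (isCompact_singleton (x := y))
  exact .of_isCompact (hφ.1.evalMul continuous_id continuous_const) hC fun x hx => by
    by_contra h'
    exact hx (h y rfl x h')

theorem IsTest.comp_inv {φ : K → ℝ} (hφ : IsTest φ) : IsTest fun z => φ (inv z) := by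
  refine .of_isCompact (hφ.1.comp continuous_inv) (hφ.2.isCompact.image continuous_inv)
    fun z hz => IsTest.eq_zero fun h => hz ⟨inv z, h, inv_inv z⟩

/-- Uniform continuity of test functions under small right translations. -/
theorem IsTest.exists_nhds_right {φ : K → ℝ} (hφ : IsTest φ) {ε : ℝ} (hε : 0 < ε) :
    ∃ W ∈ 𝓝 (e : K), ∀ t, ∀ w ∈ W, ∀ y ∈ supp t w, |φ y - φ t| ≤ ε := by
  obtain ⟨V, hV, hVe⟩ := exists_compact_mem_nhds (e : K)
  -- For `t ∉ C` no `supp t w` with `w ∈ V` meets the support of `φ`, so `φ y` vanishes; the case `w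
  -- = e` gives `φ t = 0`. Only `t ∈ C` needs an estimate.
  obtain ⟨C, hC, hCV⟩ := exists_isCompact_left hV hφ.2
  have h1 : ∀ᶠ w in 𝓝 (e : K), ∀ t ∈ C, ∀ y ∈ supp t w, |φ y - φ t| ≤ ε := by
    refine hC.eventually_forall_of_forall_eventually fun t _ => ?_
    have hO : IsOpen {z | |φ z - φ t| < ε / 2} :=
      isOpen_lt ((hφ.1.sub continuous_const).abs) continuous_const
    have hs : supp t e ⊆ {z | |φ z - φ t| < ε / 2} := by
      rw [supp_e_right]
      simpa using half_pos hε
    have h2 := eventually_supp_subset hO hs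
    have h3 : ∀ᶠ q : K × K in 𝓝 (e, t), supp q.2 q.1 ⊆ {z | |φ z - φ t| < ε / 2} :=
      (continuous_swap.tendsto ((e : K), t)).eventually h2
    have h4 : ∀ᶠ q : K × K in 𝓝 (e, t), |φ q.2 - φ t| < ε / 2 :=
      (continuous_snd.tendsto ((e : K), t)).eventually
        (hO.mem_nhds (by simpa using half_pos hε))
    filter_upwards [h3, h4] with q hq hq' y hy
    have h5 : |φ y - φ t| < ε / 2 := hq hy
    rw [abs_lt] at *
    rw [abs_le]
    constructor <;> linarith
  refine ⟨_, inter_mem hVe h1, fun t w hw y hy => ?_⟩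
  by_cases ht : t ∈ C
  · exact hw.2 t ht y hy
  · have hy0 : φ y = 0 := IsTest.eq_zero fun h => ht (hCV w hw.1 t y hy h)
    have ht0 : φ t = 0 := by
      refine IsTest.eq_zero fun h => ht ?_
      have he := mem_of_mem_nhds hVe
      exact hCV e he t t (by rw [supp_e_right]; rfl) h
    simp [hy0, ht0, hε.le]

end Translates

/-! ### Haar measure: full support and the adjoint of left translation. -/

section Haar

variable {K : Type*} [TopologicalSpace K] [T2Space K] [LocallyCompactSpace K]
  [MeasurableSpace K] [BorelSpace K] [Hypergroup K] {ω : Measure K}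

theorem IsLeftHaar.isFiniteMeasureOnCompacts (hω : IsLeftHaar ω) :
    IsFiniteMeasureOnCompacts ω := by
  have := hω.regular
  infer_instance

/-- A bump at `x₀` inside a null open set has integral `0`, and so have its left translates. For
each `y₀` some translate is positive at `y₀`: take `x` in `supp x₀ (inv y₀)`, so that `x₀ ∈ supp x
y₀`. Hence `ω` is locally null, and zero by inner regularity. -/
theorem IsLeftHaar.isOpenPosMeasure (hω : IsLeftHaar ω) : ω.IsOpenPosMeasure := by
  have := hω.regular
  refine ⟨fun O hO ⟨x₀, hx₀⟩ h0 => hω.ne_zero ?_⟩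
  obtain ⟨φ, φc, φs, φ1, φ0, -, φO⟩ := exists_cutoff (isCompact_singleton (x := x₀)) hO
    (singleton_subset_iff.2 hx₀)
  have hφ : IsTest φ := ⟨φc, φs⟩
  have hint : ∫ y, φ y ∂ω = 0 := by
    rw [← integral_zero K ℝ]
    refine integral_congr_ae ?_
    have : ∀ᵐ y ∂ω, y ∉ O := measure_eq_zero_iff_ae_notMem.1 h0
    filter_upwards [this] with y hy
    exact IsTest.eq_zero fun h => hy (φO h)
  have key : ∀ y₀ : K, ∃ N ∈ 𝓝 y₀, ω N = 0 := by
    intro y₀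
    obtain ⟨x, hx⟩ := supp_nonempty x₀ (inv y₀)
    have hx' := mem_supp_left hx
    rw [inv_inv] at hx'
    have hpos := evalMul_pos φc φ0 hx' (by rw [φ1 x₀ rfl]; exact one_pos)
    refine ⟨Function.support fun y => evalMul φ x y,
      (hφ.evalMul_right x).1.isOpen_support.mem_nhds hpos.ne', ?_⟩
    have h1 := hω.integral_translate x φ φc φs
    rw [hint] at h1
    by_contra h2
    have h3 := (integral_pos_iff_support_of_nonneg
      (fun y => evalMul_nonneg fun z _ => φ0 z)
      ((hφ.evalMul_right x).integrable ω)).2 (pos_iff_ne_zero.2 h2)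
    exact h3.ne' h1
  rw [← Measure.measure_univ_eq_zero, isOpen_univ.measure_eq_iSup_isCompact]
  simp only [ENNReal.iSup_eq_zero]
  intro C _ hC
  refine hC.measure_zero_of_nhdsWithin fun y _ => ?_
  obtain ⟨N, hN, h⟩ := key y
  exact ⟨N, mem_nhdsWithin_of_mem_nhds hN, h⟩

/-- Symmetric nonnegative test functions of integral `1` that vanish outside of `W`. -/
structure IsBump (ω : Measure K) (W : Set K) (k : K → ℝ) : Prop extends IsTest k where
  nonneg : ∀ z, 0 ≤ k z
  symm : ∀ z, k (inv z) = k z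
  mem_of_ne_zero : ∀ z, k z ≠ 0 → z ∈ W
  integral_eq_one : ∫ z, k z ∂ω = 1

theorem inv_e : inv (e : K) = e := by
  have h : (e : K) ∈ supp (e : K) e := by rw [supp_e_left]; rfl
  exact ((e_mem_support_conv_iff _ _).1 h).symm

theorem IsLeftHaar.exists_isBump (hω : IsLeftHaar ω) {W : Set K} (hW : W ∈ 𝓝 (e : K)) :
    ∃ k, IsBump ω W k := by
  have := hω.isOpenPosMeasure
  have := hω.isFiniteMeasureOnCompacts
  have hW' : W ∩ inv ⁻¹' W ∈ 𝓝 (e : K) :=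
    inter_mem hW (continuous_inv.continuousAt.preimage_mem_nhds (by rwa [inv_e]))
  obtain ⟨φ, φc, φs, φ1, φ0, -, φO⟩ := exists_cutoff (isCompact_singleton (x := (e : K)))
    isOpen_interior (singleton_subset_iff.2 (mem_interior_iff_mem_nhds.2 hW'))
  have hφ : IsTest φ := ⟨φc, φs⟩
  have hψ := hφ.add hφ.comp_inv
  have hpos : 0 < ∫ z, (φ z + φ (inv z)) ∂ω := by
    refine hψ.1.integral_pos_of_hasCompactSupport_nonneg_nonzero hψ.2
      (fun z => add_nonneg (φ0 _) (φ0 _)) (x := e) ?_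
    rw [inv_e, φ1 e rfl]
    norm_num
  set c := ∫ z, (φ z + φ (inv z)) ∂ω
  refine ⟨fun z => c⁻¹ * (φ z + φ (inv z)), hψ.mul_left continuous_const, fun z => ?_,
    fun z => ?_, fun z hz => ?_, ?_⟩
  · exact mul_nonneg (inv_nonneg.2 hpos.le) (add_nonneg (φ0 _) (φ0 _))
  · rw [inv_inv, add_comm]
  · by_cases h : φ z = 0
    · have h' : φ (inv z) ≠ 0 := fun h' => hz (by simp [h, h'])
      have := (interior_subset (φO (subset_tsupport _ h'))).2
      rwa [mem_preimage, inv_inv] at this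
    · exact (interior_subset (φO (subset_tsupport _ h))).1
  · rw [integral_const_mul]
    exact inv_mul_cancel₀ hpos.ne'

/-- The smoothing operator `φ ↦ ∫ φ(y) k(t⁻ * y) dω(y)`. -/
noncomputable def smooth (ω : Measure K) (k φ : K → ℝ) (t : K) : ℝ :=
  ∫ y, φ y * evalMul k (inv t) y ∂ω

/-- By left invariance `y ↦ k (t⁻ * y)` has integral `1`, and it is nonzero only at `y ∈ supp t w`
for some `w ∈ W`. So `smooth` averages `φ` near `t`. -/
theorem abs_smooth_sub_le (hω : IsLeftHaar ω) {φ k : K → ℝ} (hφ : IsTest φ) {W : Set K}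
    (hk : IsBump ω W k) {ε : ℝ}
    (h : ∀ t, ∀ w ∈ W, ∀ y ∈ supp t w, |φ y - φ t| ≤ ε) (t : K) :
    |smooth ω k φ t - φ t| ≤ ε := by
  have := hω.isFiniteMeasureOnCompacts
  have hT := hk.toIsTest.evalMul_right (inv t)
  have h1 : ∫ y, evalMul k (inv t) y ∂ω = 1 := by
    rw [hω.integral_translate _ k hk.continuous hk.hasCompactSupport, hk.integral_eq_one]
  have h2 : smooth ω k φ t - φ t = ∫ y, (φ y - φ t) * evalMul k (inv t) y ∂ω := by
    simp_rw [sub_mul]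
    rw [integral_sub ((hT.mul_left hφ.1).integrable ω) ((hT.integrable ω).const_mul _),
      integral_const_mul, h1, mul_one, smooth]
  rw [h2]
  calc |∫ y, (φ y - φ t) * evalMul k (inv t) y ∂ω|
      ≤ ∫ y, |(φ y - φ t) * evalMul k (inv t) y| ∂ω := abs_integral_le_integral_abs
    _ ≤ ∫ y, ε * evalMul k (inv t) y ∂ω := by
        refine integral_mono ((hT.mul_left (ψ := fun y => φ y - φ t)
          (hφ.1.sub continuous_const)).abs.integrable ω) ?_ ?_
        · exact (hT.integrable ω).const_mul _
        · intro y
          have hk0 : 0 ≤ evalMul k (inv t) y := evalMul_nonneg fun z _ => hk.nonneg z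
          simp only [abs_mul, abs_of_nonneg hk0]
          by_cases hz : evalMul k (inv t) y = 0
          · simp [hz]
          · obtain ⟨w, hw, hw'⟩ := exists_mem_supp_of_evalMul_ne_zero hz
            have := mem_supp_right hw
            rw [inv_inv] at this
            exact mul_le_mul_of_nonneg_right (h t w (hk.mem_of_ne_zero w hw') y this) hk0
    _ = ε := by rw [integral_const_mul, h1, mul_one]

theorem continuous_smooth (hω : IsLeftHaar ω) {φ k : K → ℝ} (hφ : IsTest φ)
    (hk : Continuous k) : Continuous (smooth ω k φ) := by
  have := hω.isFiniteMeasureOnCompacts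
  have := continuous_inv (K := K)
  refine continuous_integral_of_locally_compact_support ω
    (F := fun t y => φ y * evalMul k (inv t) y) ?_ fun t => ⟨univ, univ_mem, _, hφ.2, ?_⟩
  · have := hφ.1
    fun_prop
  · intro x _ y hy
    exact subset_tsupport _ (left_ne_zero_of_mul hy)

/-- For smoothed functions the adjoint relation is exact: by associativity and the symmetry of `k`,
both sides are the double integral of `φ y * ψ z` against `k (z⁻ * x⁻ * y)`. -/
theorem integral_mul_evalMul_smooth (hω : IsLeftHaar ω) {φ ψ k : K → ℝ} (hφ : IsTest φ)
    (hψ : IsTest ψ) (hk : Continuous k) (hs : ∀ z, k (inv z) = k z) (x : K) :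
    ∫ y, φ y * evalMul (smooth ω k ψ) (inv x) y ∂ω =
      ∫ z, evalMul (smooth ω k φ) x z * ψ z ∂ω := by
  have := hω.isFiniteMeasureOnCompacts
  have hi := continuous_inv (K := K)
  have hφc := hφ.1
  have hψc := hψ.1
  let E : K → K → ℝ := fun z y => evalMul (fun w => evalMul k (inv w) y) x z
  have hE : Continuous fun p : K × K => E p.1 p.2 := by
    have h1 : Continuous fun q : K × K => evalMul k (inv q.1) q.2 := by fun_prop
    exact (continuous_integral_conv h1).comp (f := fun p : K × K => ((x, p.1), p.2))
      (by fun_prop)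
  have e1 : ∀ y, evalMul (smooth ω k ψ) (inv x) y = ∫ z, ψ z * E z y ∂ω := by
    intro y
    unfold smooth
    rw [evalMul_integral ω (F := fun s z => ψ z * evalMul k (inv s) z) (by fun_prop) hψ.2
      fun t _ z hz => subset_tsupport _ (left_ne_zero_of_mul hz)]
    congr 1
    ext z
    rw [evalMul_const_mul]
    congr 1
    have h1 : ∀ s, evalMul k (inv s) z = evalMul k (inv z) s := by
      intro s
      conv_rhs => rw [← inv_inv s, evalMul_inv]
      simp_rw [hs]
    simp_rw [h1]
    rw [← evalMul_assoc hk, evalMul_inv]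
  have e2 : ∀ z, evalMul (smooth ω k φ) x z = ∫ y, φ y * E z y ∂ω := by
    intro z
    unfold smooth
    rw [evalMul_integral ω (F := fun s z => φ z * evalMul k (inv s) z) (by fun_prop) hφ.2
      fun t _ z hz => subset_tsupport _ (left_ne_zero_of_mul hz)]
    congr 1
    ext y
    rw [evalMul_const_mul]
  simp_rw [e1, e2, ← integral_const_mul, ← integral_mul_const]
  rw [integral_integral_swap_of_isCompact ω ω (by fun_prop) hφ.2 hψ.2]
  · congr 1
    ext z
    congr 1
    ext y
    ring
  · intro y z h
    exact ⟨subset_tsupport _ (left_ne_zero_of_mul h),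
      subset_tsupport _ (left_ne_zero_of_mul (right_ne_zero_of_mul h))⟩

/-- Left translation by `x⁻` is the adjoint of left translation by `x`. -/
theorem integral_evalMul_mul (hω : IsLeftHaar ω) {φ ψ : K → ℝ} (hφ : IsTest φ)
    (hψ : IsTest ψ) (x : K) :
    ∫ y, evalMul φ x y * ψ y ∂ω = ∫ y, φ y * evalMul ψ (inv x) y ∂ω := by
  have := hω.isFiniteMeasureOnCompacts
  have key : ∀ {u φ ψ : K → ℝ} {ε : ℝ} (x : K), Continuous u → IsTest φ → IsTest ψ →
      (∀ t, |u t - φ t| ≤ ε) →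
      |∫ y, evalMul u x y * ψ y ∂ω - ∫ y, evalMul φ x y * ψ y ∂ω| ≤ ε * ∫ y, |ψ y| ∂ω := by
    intro u φ ψ ε x hu hφ hψ h
    have hT : ∀ {u : K → ℝ}, Continuous u → Integrable (fun y => evalMul u x y * ψ y) ω :=
      fun hu => (hψ.mul_left (hu.evalMul continuous_const continuous_id)).integrable ω
    rw [← integral_sub (hT hu) (hT hφ.1),
      ← integral_const_mul]
    refine abs_integral_le_integral_abs.trans (integral_mono_of_nonneg
      (.of_forall fun y => abs_nonneg _) ((hψ.abs.integrable ω).const_mul _)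
      (.of_forall fun y => ?_))
    simp only [← sub_mul, abs_mul]
    refine mul_le_mul_of_nonneg_right ?_ (abs_nonneg _)
    have : evalMul u x y - evalMul φ x y = evalMul (fun z => u z - φ z) x y :=
      (integral_sub (integrable_conv hu x y) (integrable_conv hφ.1 x y)).symm
    rw [this, ← sub_zero (evalMul _ x y)]
    exact abs_evalMul_sub_le (hu.sub hφ.1) fun z _ => by rw [sub_zero]; exact h z
  set I := ∫ y, |φ y| ∂ω
  set J := ∫ y, |ψ y| ∂ω
  have hI : 0 ≤ I := integral_nonneg fun y => abs_nonneg _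
  have hJ : 0 ≤ J := integral_nonneg fun y => abs_nonneg _
  -- Replacing `φ` and `ψ` by smoothed versions within `ε` uniformly costs `ε * J` on the left and
  -- `ε * I` on the right.
  have bound : ∀ ε > 0, |∫ y, evalMul φ x y * ψ y ∂ω - ∫ y, φ y * evalMul ψ (inv x) y ∂ω|
      ≤ ε * (I + J) := by
    intro ε hε
    obtain ⟨W, hW, h1⟩ := hφ.exists_nhds_right hε
    obtain ⟨W', hW', h2⟩ := hψ.exists_nhds_right hε
    obtain ⟨k, hk⟩ := hω.exists_isBump (inter_mem hW hW')
    have a1 := key x (continuous_smooth hω hφ hk.continuous) hφ hψ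
      (abs_smooth_sub_le hω hφ hk fun t w hw => h1 t w hw.1)
    have a2 := key (inv x) (continuous_smooth hω hψ hk.continuous) hψ hφ
      (abs_smooth_sub_le hω hψ hk fun t w hw => h2 t w hw.2)
    have a3 := integral_mul_evalMul_smooth hω hφ hψ hk.continuous hk.symm x
    simp only [mul_comm (φ _)] at a3 ⊢
    rw [abs_le] at *
    constructor <;> nlinarith
  refine sub_eq_zero.1 (abs_nonpos_iff.1 (le_of_forall_pos_le_add fun δ hδ => ?_))
  have hp : 0 < I + J + 1 := by positivity
  refine (bound (δ / (I + J + 1)) (by positivity)).trans ?_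
  rw [zero_add, div_mul_eq_mul_div, div_le_iff₀ hp]
  nlinarith

end Haar

/-! ### The modular function. -/

section Modular

variable {K : Type*} [TopologicalSpace K] [T2Space K] [LocallyCompactSpace K]
  [MeasurableSpace K] [BorelSpace K] [Hypergroup K] {ω : Measure K}

theorem continuous_integral_evalMul_left (μ : Measure K) [IsFiniteMeasureOnCompacts μ]
    {φ : K → ℝ} (hφ : IsTest φ) : Continuous fun z => ∫ y, evalMul φ y z ∂μ := by
  refine continuous_integral_of_locally_compact_support μ (F := fun z y => evalMul φ y z)
    (hφ.1.evalMul continuous_snd continuous_fst) fun z => ?_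
  obtain ⟨N, hN, hz⟩ := exists_compact_mem_nhds z
  obtain ⟨C, hC, h⟩ := exists_isCompact_evalMul_left hφ hN
  exact ⟨N, hz, C, hC, h⟩

theorem continuous_integral_evalMul_right (μ : Measure K) [IsFiniteMeasureOnCompacts μ]
    {φ : K → ℝ} (hφ : IsTest φ) : Continuous fun z => ∫ y, evalMul φ z y ∂μ := by
  refine continuous_integral_of_locally_compact_support μ (F := fun z y => evalMul φ z y)
    (hφ.1.evalMul continuous_fst continuous_snd) fun z => ?_
  obtain ⟨N, hN, hz⟩ := exists_compact_mem_nhds z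
  obtain ⟨C, hC, h⟩ := exists_isCompact_evalMul_right hφ hN
  exact ⟨N, hz, C, hC, h⟩

theorem eq_zero_of_forall_integral_mul_eq_zero (hω : IsLeftHaar ω) {u : K → ℝ}
    (hu : Continuous u) (h : ∀ ψ : K → ℝ, IsTest ψ → ∫ z, ψ z * u z ∂ω = 0) (x : K) :
    u x = 0 := by
  have := hω.isOpenPosMeasure
  have := hω.isFiniteMeasureOnCompacts
  by_contra hx
  obtain ⟨χ, χc, χs, χ1, χ0, -, -⟩ := exists_cutoff (isCompact_singleton (x := x)) isOpen_univ
    (subset_univ _)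
  have hT : IsTest fun z => χ z * u z := IsTest.mul_right ⟨χc, χs⟩ hu
  have hT2 := hT.mul_right hu
  refine (hT2.1.integral_pos_of_hasCompactSupport_nonneg_nonzero (μ := ω) hT2.2 (x := x)
    (fun z => ?_) ?_).ne' (h _ hT)
  · simp only [Pi.zero_apply, mul_assoc]
    exact mul_nonneg (χ0 z) (mul_self_nonneg _)
  · simp [χ1 x rfl, hx]

/-- The adjoint relation turns `∫ ψ (z⁻) φ (y * z) dz` into `∫ φ z ψ (z⁻ * y) dz`, and left
invariance then evaluates the integral over `y`. The symmetry in `φ` and `ψ` of the result is what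
makes `modular` exist. -/
theorem integral_inv_mul_integral_evalMul (hω : IsLeftHaar ω) {φ ψ : K → ℝ} (hφ : IsTest φ)
    (hψ : IsTest ψ) :
    ∫ z, ψ (inv z) * ∫ y, evalMul φ y z ∂ω ∂ω = (∫ y, φ y ∂ω) * ∫ y, ψ y ∂ω := by
  have := hω.isFiniteMeasureOnCompacts
  have hi := continuous_inv (K := K)
  have hφc := hφ.1
  have hψc := hψ.1
  have hψi := hψ.comp_inv
  simp_rw [← integral_const_mul]
  obtain ⟨C, hC, h⟩ := exists_isCompact_evalMul_left hφ hψi.2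
  rw [integral_integral_swap_of_isCompact ω ω (by fun_prop) hψi.2 hC]
  · have e1 : ∀ y, ∫ x, ψ (inv x) * evalMul φ y x ∂ω = ∫ z, φ z * evalMul ψ (inv z) y ∂ω := by
      intro y
      simp_rw [mul_comm (ψ _)]
      rw [integral_evalMul_mul hω hφ hψi y]
      congr 1
      ext z
      rw [← evalMul_inv, inv_inv]
    simp_rw [e1]
    obtain ⟨C, hC, h⟩ := exists_isCompact_evalMul_right hψ (hφ.2.isCompact.image hi)
    rw [integral_integral_swap_of_isCompact ω ω (by fun_prop) hC hφ.2]
    · simp_rw [integral_const_mul]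
      have : ∀ z, ∫ y, evalMul ψ (inv z) y ∂ω = ∫ y, ψ y ∂ω := fun z =>
        hω.integral_translate _ ψ hψ.1 hψ.2
      simp_rw [this, integral_mul_const]
    · intro y z hyz
      have hz := subset_tsupport _ (left_ne_zero_of_mul hyz)
      exact ⟨h _ (mem_image_of_mem _ hz) y (right_ne_zero_of_mul hyz), hz⟩
  · intro z y hzy
    have hz : z ∈ tsupport fun z => ψ (inv z) := subset_tsupport _ (left_ne_zero_of_mul hzy)
    exact ⟨hz, h z hz y (right_ne_zero_of_mul hzy)⟩

theorem integral_evalMul_comm (hω : IsLeftHaar ω) {φ ψ : K → ℝ} (hφ : IsTest φ)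
    (hψ : IsTest ψ) (z : K) :
    (∫ y, evalMul φ y z ∂ω) * ∫ y, ψ y ∂ω = (∫ y, evalMul ψ y z ∂ω) * ∫ y, φ y ∂ω := by
  have := hω.isFiniteMeasureOnCompacts
  have c1 := continuous_integral_evalMul_left ω hφ
  have c2 := continuous_integral_evalMul_left ω hψ
  refine sub_eq_zero.1 (eq_zero_of_forall_integral_mul_eq_zero hω
    (u := fun z => (∫ y, evalMul φ y z ∂ω) * (∫ y, ψ y ∂ω)
      - (∫ y, evalMul ψ y z ∂ω) * ∫ y, φ y ∂ω) (by fun_prop) (fun θ hθ => ?_) z)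
  have h1 := integral_inv_mul_integral_evalMul hω hφ hθ.comp_inv
  have h2 := integral_inv_mul_integral_evalMul hω hψ hθ.comp_inv
  simp_rw [inv_inv] at h1 h2
  simp_rw [mul_sub, ← mul_assoc]
  rw [integral_sub (((hθ.mul_right c1).integrable ω).mul_const _)
    (((hθ.mul_right c2).integrable ω).mul_const _), integral_mul_const, integral_mul_const, h1, h2]
  ring

theorem integral_evalMul_inv (hω : IsLeftHaar ω) {φ : K → ℝ} (hφ : IsTest φ) (x : K) :
    ∫ y, evalMul φ y (inv x) ∂ω = modular ω x * ∫ y, φ y ∂ω := by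
  obtain ⟨k, hk⟩ := hω.exists_isBump univ_mem
  refine Classical.epsilon_spec (p := fun c : ℝ => ∀ φ : K → ℝ, Continuous φ →
    HasCompactSupport φ → ∫ y, evalMul φ y (inv x) ∂ω = c * ∫ y, φ y ∂ω)
    ⟨∫ y, evalMul k y (inv x) ∂ω, fun φ h1 h2 => ?_⟩ φ hφ.1 hφ.2
  -- Comparison with one normalised function `k` shows that the value of its integral is the
  -- required constant.
  have := integral_evalMul_comm hω ⟨h1, h2⟩ hk.toIsTest (inv x)
  rwa [hk.integral_eq_one, mul_one] at this

theorem integral_evalMul_left (hω : IsLeftHaar ω) {φ : K → ℝ} (hφ : IsTest φ) (x : K) :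
    ∫ y, evalMul φ y x ∂ω = modular ω (inv x) * ∫ y, φ y ∂ω := by
  rw [← integral_evalMul_inv hω hφ, inv_inv]

theorem continuous_modular (hω : IsLeftHaar ω) : Continuous (modular ω) := by
  have := hω.isFiniteMeasureOnCompacts
  obtain ⟨k, hk⟩ := hω.exists_isBump univ_mem
  have h : modular ω = fun x => ∫ y, evalMul k y (inv x) ∂ω := by
    ext x
    rw [integral_evalMul_inv hω hk.toIsTest, hk.integral_eq_one, mul_one]
  rw [h]
  exact (continuous_integral_evalMul_left ω hk.toIsTest).comp continuous_inv

theorem integral_inv_mul_modular (hω : IsLeftHaar ω) {ψ : K → ℝ} (hψ : IsTest ψ) :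
    ∫ z, ψ (inv z) * modular ω (inv z) ∂ω = ∫ z, ψ z ∂ω := by
  obtain ⟨k, hk⟩ := hω.exists_isBump univ_mem
  have := integral_inv_mul_integral_evalMul hω hk.toIsTest hψ
  simpa only [integral_evalMul_left hω hk.toIsTest, hk.integral_eq_one, mul_one, one_mul]
    using this

/-- The inversion formula `integral_inv_mul_modular`, applied twice, returns `ψ` multiplied by `Δ(z)
Δ(z⁻)`. -/
theorem modular_mul_modular_inv (hω : IsLeftHaar ω) (x : K) :
    modular ω x * modular ω (inv x) = 1 := by
  have := hω.isFiniteMeasureOnCompacts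
  have hΔ := continuous_modular hω
  have hi := continuous_inv (K := K)
  refine sub_eq_zero.1 (eq_zero_of_forall_integral_mul_eq_zero hω
    (u := fun x => modular ω x * modular ω (inv x) - 1) (by fun_prop) (fun ψ hψ => ?_) x)
  have hT : IsTest fun z => ψ (inv z) * modular ω (inv z) :=
    hψ.comp_inv.mul_right (hΔ.comp hi)
  have h1 := integral_inv_mul_modular hω hT
  rw [integral_inv_mul_modular hω hψ] at h1
  simp_rw [inv_inv] at h1
  simp_rw [mul_sub, mul_one]
  rw [integral_sub ((hψ.mul_right (by fun_prop)).integrable ω) (hψ.integrable ω), ← h1]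
  simp_rw [mul_assoc]
  exact sub_self _

theorem modular_pos (hω : IsLeftHaar ω) (x : K) : 0 < modular ω x := by
  obtain ⟨k, hk⟩ := hω.exists_isBump univ_mem
  have h : modular ω x = ∫ y, evalMul k y (inv x) ∂ω := by
    rw [integral_evalMul_inv hω hk.toIsTest, hk.integral_eq_one, mul_one]
  refine lt_of_le_of_ne ?_ fun h0 => ?_
  · rw [h]
    exact integral_nonneg fun y => evalMul_nonneg fun z _ => hk.nonneg z
  · have := modular_mul_modular_inv hω x
    rw [← h0, zero_mul] at this
    exact zero_ne_one this

theorem modular_inv (hω : IsLeftHaar ω) (x : K) : modular ω (inv x) = (modular ω x)⁻¹ :=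
  (inv_eq_of_mul_eq_one_right (modular_mul_modular_inv hω x)).symm

theorem evalMul_modular (hω : IsLeftHaar ω) (x y : K) :
    evalMul (modular ω) x y = modular ω x * modular ω y := by
  have := hω.isFiniteMeasureOnCompacts
  obtain ⟨k, hk⟩ := hω.exists_isBump univ_mem
  have hkT := hk.toIsTest
  have hkc := hkT.1
  obtain ⟨C, hC, h⟩ := exists_isCompact_evalMul_left hkT (isCompact_supp (inv y) (inv x))
  have h1 := evalMul_integral ω (F := fun s w => evalMul k w s) (by fun_prop) hC h
  simp_rw [integral_evalMul_left hω hkT, hk.integral_eq_one, mul_one] at h1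
  rw [evalMul_inv (fun s => modular ω (inv s))] at h1
  simp_rw [inv_inv, ← evalMul_assoc hkc] at h1
  rw [integral_evalMul_inv hω (hkT.evalMul_left (inv x)), integral_evalMul_inv hω hkT,
    hk.integral_eq_one, mul_one] at h1
  rw [mul_comm]
  exact h1

/-- By `evalMul_modular`, `Δ` has mean `c = Δ(x) Δ(y)` under `ε_x * ε_y`, and `1 / Δ` has mean `1 /
c`. So the nonnegative function `Δ / c + c / Δ - 2` has integral zero and vanishes on the support,
which forces `Δ = c` there. -/
theorem modular_eq_of_mem_supp (hω : IsLeftHaar ω) {x y z : K} (hz : z ∈ supp x y) :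
    modular ω z = modular ω x * modular ω y := by
  have hΔ := continuous_modular hω
  have hi := continuous_inv (K := K)
  set c := modular ω x * modular ω y with hc
  have hc0 : 0 < c := mul_pos (modular_pos hω x) (modular_pos hω y)
  let φ : K → ℝ := fun z => c⁻¹ * modular ω z + c * modular ω (inv z) - 2
  have hφ : Continuous φ := by fun_prop
  have e : ∀ z, φ z = c⁻¹ * modular ω (inv z) * (modular ω z - c) ^ 2 := by
    intro z
    have := modular_pos hω z
    simp only [φ, modular_inv hω]
    field_simp
    ring
  have h0 : ∀ z, 0 ≤ φ z := fun z => by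
    rw [e]
    have := modular_pos hω (inv z)
    positivity
  have hint : evalMul φ x y = 0 := by
    have h1 : evalMul φ x y = c⁻¹ * evalMul (modular ω) x y
        + c * evalMul (fun z => modular ω (inv z)) x y - 2 := by
      have i1 : Integrable (fun z => c⁻¹ * modular ω z) (conv x y : Measure K) :=
        (integrable_conv hΔ x y).const_mul _
      have i2 : Integrable (fun z => c * modular ω (inv z)) (conv x y : Measure K) :=
        (integrable_conv (hΔ.comp hi) x y).const_mul _
      have h1 := integral_sub (i1.add i2) (integrable_const (2 : ℝ))
      simp only [Pi.add_apply] at h1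
      simp only [φ]
      unfold evalMul
      rw [h1, integral_add i1 i2, integral_const_mul, integral_const_mul]
      simp
    rw [h1, ← evalMul_inv, evalMul_modular hω, evalMul_modular hω, modular_inv hω,
      modular_inv hω, ← mul_inv, mul_comm (modular ω y), ← hc, inv_mul_cancel₀ hc0.ne',
      mul_inv_cancel₀ hc0.ne']
    norm_num
  by_contra hne
  refine (evalMul_pos hφ h0 hz ?_).ne' hint
  rw [e]
  have := modular_pos hω (inv z)
  have := sub_ne_zero.2 hne
  positivity

end Modular

/-! ### The convolution `g * h^*`: its `L¹` norm, adjoint and translates. -/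

section Corr

variable {K : Type*} [TopologicalSpace K] [T2Space K] [LocallyCompactSpace K]
  [MeasurableSpace K] [BorelSpace K] [Hypergroup K] {ω : Measure K}

/-- The convolution `g * h^*` for real-valued functions. -/
noncomputable def corr (ω : Measure K) (g h : K → ℝ) (x : K) : ℝ :=
  ∫ y, evalMul g x y * (h y * modular ω y) ∂ω

theorem IsTest.mul_modular (hω : IsLeftHaar ω) {h : K → ℝ} (hh : IsTest h) :
    IsTest fun y => h y * modular ω y :=
  hh.mul_right (continuous_modular hω)

theorem exists_isCompact_corr {A B : Set K} (hA : IsCompact A) (hB : IsCompact B) :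
    ∃ C, IsCompact C ∧ ∀ g h : K → ℝ, (∀ z, g z ≠ 0 → z ∈ A) → (∀ z, h z ≠ 0 → z ∈ B) →
      ∀ x, corr ω g h x ≠ 0 → x ∈ C := by
  obtain ⟨C, hC, H⟩ := exists_isCompact_left hB hA
  refine ⟨C, hC, fun g h hg hh x hx => ?_⟩
  by_contra hxC
  refine hx ?_
  rw [corr, ← integral_zero K ℝ]
  congr 1
  ext y
  by_contra hne
  obtain ⟨z, hz, hz'⟩ := exists_mem_supp_of_evalMul_ne_zero (left_ne_zero_of_mul hne)
  exact hxC (H y (hh y (left_ne_zero_of_mul (right_ne_zero_of_mul hne))) x z hz (hg z hz'))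

theorem IsTest.corr (hω : IsLeftHaar ω) {g h : K → ℝ} (hg : IsTest g) (hh : IsTest h) :
    IsTest (corr ω g h) := by
  have := hω.isFiniteMeasureOnCompacts
  have hΔ := continuous_modular hω
  have hgc := hg.1
  have hhc := hh.1
  obtain ⟨C, hC, H⟩ := exists_isCompact_corr (ω := ω) hg.2.isCompact hh.2.isCompact
  refine .of_isCompact ?_ hC fun z hz => ?_
  · refine continuous_integral_of_locally_compact_support ω
      (F := fun x y => evalMul g x y * (h y * modular ω y)) (by fun_prop)
      fun t => ⟨univ, univ_mem, _, hh.2, fun x _ y hy => subset_tsupport _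
        (left_ne_zero_of_mul (right_ne_zero_of_mul hy))⟩
  · by_contra hne
    exact hz (H g h (fun z => (subset_tsupport g ·)) (fun z => (subset_tsupport h ·)) z hne)

theorem integral_corr (hω : IsLeftHaar ω) {g h : K → ℝ} (hg : IsTest g) (hh : IsTest h) :
    ∫ x, corr ω g h x ∂ω = (∫ x, g x ∂ω) * ∫ x, h x ∂ω := by
  have := hω.isFiniteMeasureOnCompacts
  have hΔ := continuous_modular hω
  have hgc := hg.1
  have hhc := hh.1
  obtain ⟨C, hC, H⟩ := exists_isCompact_evalMul_left hg hh.2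
  unfold corr
  rw [integral_integral_swap_of_isCompact ω ω (by fun_prop) hC hh.2]
  · simp_rw [integral_mul_const, integral_evalMul_left hω hg]
    rw [← integral_const_mul]
    congr 1
    ext y
    linear_combination (∫ x, g x ∂ω) * h y * modular_mul_modular_inv hω y
  · intro x y hxy
    have hy := subset_tsupport _ (left_ne_zero_of_mul (right_ne_zero_of_mul hxy))
    exact ⟨H y hy x (left_ne_zero_of_mul hxy), hy⟩

theorem abs_corr_le (hω : IsLeftHaar ω) {g h : K → ℝ} (hg : IsTest g) (hh : IsTest h) (x : K) :
    |corr ω g h x| ≤ corr ω (fun z => |g z|) (fun z => |h z|) x := by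
  have := hω.isFiniteMeasureOnCompacts
  refine abs_integral_le_integral_abs.trans (integral_mono ?_ ?_ fun y => ?_)
  · exact ((hh.mul_modular hω).mul_left
      (hg.1.evalMul continuous_const continuous_id)).abs.integrable ω
  · exact ((hh.abs.mul_modular hω).mul_left
      (hg.abs.1.evalMul continuous_const continuous_id)).integrable ω
  · simp only [abs_mul, abs_of_pos (modular_pos hω y)]
    have := modular_pos hω y
    gcongr
    exact abs_evalMul_le g x y

theorem integral_abs_corr_le (hω : IsLeftHaar ω) {g h : K → ℝ} (hg : IsTest g)
    (hh : IsTest h) :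
    ∫ x, |corr ω g h x| ∂ω ≤ (∫ x, |g x| ∂ω) * ∫ x, |h x| ∂ω := by
  have := hω.isFiniteMeasureOnCompacts
  rw [← integral_corr hω hg.abs hh.abs]
  exact integral_mono ((hg.corr hω hh).abs.integrable ω)
    ((hg.abs.corr hω hh.abs).integrable ω) (abs_corr_le hω hg hh)

/-- This is `(g * h^*)^* = h * g^*`. The factor `Δ(x⁻)` comes out because `Δ` is multiplicative on
supports. -/
theorem corr_swap (hω : IsLeftHaar ω) {g h : K → ℝ} (hg : IsTest g) (hh : IsTest h) (x : K) :
    corr ω h g x = corr ω g h (inv x) * modular ω (inv x) := by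
  unfold corr
  rw [integral_evalMul_mul hω hh (hg.mul_modular hω), ← integral_mul_const]
  congr 1
  ext y
  have : evalMul (fun y => g y * modular ω y) (inv x) y
      = evalMul g (inv x) y * (modular ω (inv x) * modular ω y) := by
    unfold evalMul
    rw [← integral_mul_const]
    refine integral_congr_ae ((ae_mem_supp _ _).mono fun z hz => ?_)
    simp only [modular_eq_of_mem_supp hω hz]
  rw [this]
  ring

/-- Real functions `h` with `h^* = h`. -/
def IsSelfAdj (ω : Measure K) (h : K → ℝ) : Prop :=
  ∀ x, h (inv x) * modular ω (inv x) = h x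

theorem isSelfAdj_corr (hω : IsLeftHaar ω) {h : K → ℝ} (hh : IsTest h) :
    IsSelfAdj ω (corr ω h h) :=
  fun x => (corr_swap hω hh hh x).symm

theorem corr_eq_of_isSelfAdj (hω : IsLeftHaar ω) {g h : K → ℝ} (hg : IsTest g) (hh : IsTest h)
    (hs : IsSelfAdj ω h) (x : K) :
    corr ω g h x = ∫ z, g z * evalMul h (inv z) x ∂ω := by
  unfold corr
  rw [integral_evalMul_mul hω hg (hh.mul_modular hω)]
  congr 1
  ext z
  conv_rhs => rw [← inv_inv x, evalMul_inv]
  congr 2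
  ext y
  rw [← hs (inv y), inv_inv]

/-- The integrals of the left translates of `|φ|` are bounded by `C`. -/
def TranslateBound (η : Measure K) (φ : K → ℝ) (C : ℝ) : Prop :=
  ∀ x, ∫ y, evalMul (fun z => |φ z|) x y ∂η ≤ C

/-- For `h^* = h`, `g * h` is the superposition of the left translates of `h` by `z⁻` with weights
`g z`. Translating by `x` turns each into an average of translates of `h` over `ε_{z⁻} * ε_x`, still
bounded by `C`. -/
theorem TranslateBound.corr (hω : IsLeftHaar ω) {η : Measure K} [IsFiniteMeasureOnCompacts η]
    {g h : K → ℝ} (hg : IsTest g) (hh : IsTest h) (hs : IsSelfAdj ω h) {C : ℝ}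
    (hb : TranslateBound η h C) :
    TranslateBound η (Hypergroup.corr ω g h) ((∫ z, |g z| ∂ω) * C) := by
  intro x
  have := hω.isFiniteMeasureOnCompacts
  have hi := continuous_inv (K := K)
  have hgc := hg.1
  have hac := hh.abs.1
  have hga := hg.abs.1
  have c0 : Continuous fun p : K × K => evalMul (fun w => |h w|) (inv p.2) p.1 := by fun_prop
  have c1 : Continuous fun s => ∫ z, |g z| * evalMul (fun w => |h w|) (inv z) s ∂ω := by
    refine continuous_integral_of_locally_compact_support ω
      (F := fun s z => |g z| * evalMul (fun w => |h w|) (inv z) s) (by fun_prop)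
      fun t => ⟨univ, univ_mem, _, hg.abs.2, fun x _ y hy => subset_tsupport _
        (left_ne_zero_of_mul hy)⟩
  let G : K → K → ℝ := fun z y => evalMul (fun t => evalMul (fun w => |h w|) t y) (inv z) x
  have hG : Continuous fun p : K × K => G p.1 p.2 := by
    have h1 : Continuous fun q : K × K => evalMul (fun w => |h w|) q.1 q.2 := by fun_prop
    exact (continuous_integral_conv h1).comp (f := fun p : K × K => ((inv p.1, x), p.2))
      (by fun_prop)
  have step1 : ∀ y, evalMul (fun s => |Hypergroup.corr ω g h s|) x y ≤ ∫ z, |g z| * G z y ∂ω := by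
    intro y
    calc evalMul (fun s => |Hypergroup.corr ω g h s|) x y
        ≤ evalMul (fun s => ∫ z, |g z| * evalMul (fun w => |h w|) (inv z) s ∂ω) x y := by
          refine evalMul_mono (hg.corr hω hh).abs.1 c1 fun s _ => ?_
          rw [corr_eq_of_isSelfAdj hω hg hh hs]
          refine abs_integral_le_integral_abs.trans (integral_mono ?_ ?_ fun z => ?_)
          · exact (hg.mul_right (hh.1.evalMul hi continuous_const)).abs.integrable ω
          · exact (hg.abs.mul_right (hac.evalMul hi continuous_const)).integrable ω
          · simp only [abs_mul]
            gcongr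
            exact abs_evalMul_le h _ _
      _ = ∫ z, |g z| * G z y ∂ω := by
          rw [evalMul_integral ω (F := fun s z => |g z| * evalMul (fun w => |h w|) (inv z) s)
            (by fun_prop) hg.abs.2
            fun t _ z hz => subset_tsupport _ (left_ne_zero_of_mul hz)]
          congr 1
          ext z
          rw [evalMul_const_mul, ← evalMul_assoc hac]
  obtain ⟨T, hT, hT'⟩ := exists_isCompact_supp_subset
    ((hg.abs.2.isCompact.image hi).prod (isCompact_singleton (x := x)))
  obtain ⟨D, hD, hD'⟩ := exists_isCompact_evalMul_right hh.abs hT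
  have hsupp : ∀ z y, |g z| * G z y ≠ 0 → z ∈ tsupport (fun z => |g z|) ∧ y ∈ D := by
    intro z y hzy
    have hz : z ∈ tsupport (fun z => |g z|) := subset_tsupport _ (left_ne_zero_of_mul hzy)
    obtain ⟨t, ht, ht'⟩ := exists_mem_supp_of_evalMul_ne_zero (right_ne_zero_of_mul hzy)
    exact ⟨hz, hD' t (hT' (inv z, x) ⟨mem_image_of_mem _ hz, rfl⟩ ht) y ht'⟩
  have hGT : IsTest fun y => ∫ z, |g z| * G z y ∂ω := by
    refine .of_isCompact (continuous_integral_of_locally_compact_support ω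
      (F := fun y z => |g z| * G z y) (by fun_prop)
      fun t => ⟨univ, univ_mem, _, hg.abs.2, fun y _ z hz => (hsupp z y hz).1⟩) hD
      fun y hy => ?_
    rw [← integral_zero K ℝ]
    congr 1
    ext z
    by_contra hne
    exact hy (hsupp z y hne).2
  calc ∫ y, evalMul (fun z => |Hypergroup.corr ω g h z|) x y ∂η
      ≤ ∫ y, ∫ z, |g z| * G z y ∂ω ∂η :=
        integral_mono (((hg.corr hω hh).abs.evalMul_right x).integrable η)
          (hGT.integrable η) step1
    _ = ∫ z, ∫ y, |g z| * G z y ∂η ∂ω :=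
        integral_integral_swap_of_isCompact η ω (by fun_prop) hD hg.abs.2
          fun y z h => (hsupp z y h).symm
    _ ≤ ∫ z, |g z| * C ∂ω := by
        have e : ∀ z, ∫ y, |g z| * G z y ∂η
            = |g z| * evalMul (fun t => ∫ y, evalMul (fun w => |h w|) t y ∂η) (inv z) x := by
          intro z
          obtain ⟨D, hD, hD'⟩ := exists_isCompact_evalMul_right hh.abs
            (isCompact_supp (inv z) x)
          rw [integral_const_mul, evalMul_integral η (F := fun t y => evalMul (fun w => |h w|) t y)
            (by fun_prop) hD hD']
        have c2 := continuous_integral_evalMul_right η hh.abs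
        simp_rw [e]
        refine integral_mono ((hg.abs.mul_right (c2.evalMul hi continuous_const)).integrable ω)
          ((hg.abs.integrable ω).mul_const _) fun z => ?_
        refine mul_le_mul_of_nonneg_left ?_ (abs_nonneg _)
        rw [← evalMul_const C (inv z) x]
        exact evalMul_mono c2 continuous_const fun t _ => hb t
    _ = (∫ z, |g z| ∂ω) * C := integral_mul_const _ _

end Corr

/-! ### The measure `|f| ω` and the functional `φ ↦ ∫ f φ dω`. -/

section Density

variable {K : Type*} [TopologicalSpace K] [T2Space K] [LocallyCompactSpace K]
  [MeasurableSpace K] [BorelSpace K] {ω : Measure K} {f : K → ℂ}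

/-- The measure `|f| ω`. -/
noncomputable def absMeasure (ω : Measure K) (f : K → ℂ) : Measure K :=
  ω.withDensity fun y => ‖f y‖ₑ

theorem isFiniteMeasureOnCompacts_absMeasure (hf : LocallyIntegrable f ω) :
    IsFiniteMeasureOnCompacts (absMeasure ω f) := by
  refine ⟨fun C hC => ?_⟩
  rw [absMeasure, withDensity_apply _ hC.measurableSet]
  exact (hf.integrableOn_isCompact hC).2

theorem lintegral_absMeasure (hf : LocallyIntegrable f ω) {φ : K → ℝ} (hφ : IsTest φ) :
    ∫⁻ y, ENNReal.ofReal (φ y) ∂(absMeasure ω f) = ∫⁻ y, ‖f y‖ₑ * ENNReal.ofReal (φ y) ∂ω := by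
  set C := tsupport φ
  have hC : MeasurableSet C := (isClosed_tsupport φ).measurableSet
  have h1 : Function.support (fun y => ENNReal.ofReal (φ y)) ⊆ C := fun y hy =>
    subset_tsupport _ fun h => hy (by simp [h])
  have h2 : Function.support (fun y => ‖f y‖ₑ * ENNReal.ofReal (φ y)) ⊆ C := fun y hy =>
    subset_tsupport _ fun h => hy (by simp [h])
  rw [← setLIntegral_eq_of_support_subset h1, ← setLIntegral_eq_of_support_subset h2, absMeasure,
    restrict_withDensity hC, lintegral_withDensity_eq_lintegral_mul₀]
  · rfl
  · exact (hf.integrableOn_isCompact hφ.2).1.enorm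
  · exact hφ.1.measurable.ennreal_ofReal.aemeasurable

theorem ofReal_integral_absMeasure (hf : LocallyIntegrable f ω) {φ : K → ℝ} (hφ : IsTest φ)
    (h0 : ∀ y, 0 ≤ φ y) :
    ENNReal.ofReal (∫ y, φ y ∂(absMeasure ω f)) = ∫⁻ y, ‖f y‖ₑ * ENNReal.ofReal (φ y) ∂ω := by
  have := isFiniteMeasureOnCompacts_absMeasure hf
  rw [ofReal_integral_eq_lintegral_ofReal (hφ.integrable _) (.of_forall h0),
    lintegral_absMeasure hf hφ]

/-- The functional `φ ↦ ∫ f φ dω`. -/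
noncomputable def pairing (ω : Measure K) (f : K → ℂ) (φ : K → ℝ) : ℂ :=
  ∫ y, f y * (φ y : ℂ) ∂ω

theorem integrable_mul_test (hf : LocallyIntegrable f ω) {φ : K → ℝ} (hφ : IsTest φ) :
    Integrable (fun y => f y * (φ y : ℂ)) ω := by
  have := hf.integrable_smul_left_of_hasCompactSupport hφ.1 hφ.2
  refine this.congr (.of_forall fun y => ?_)
  simp [mul_comm]

theorem norm_pairing_le (hf : LocallyIntegrable f ω) {φ : K → ℝ} (hφ : IsTest φ) :
    ‖pairing ω f φ‖ ≤ ∫ y, |φ y| ∂(absMeasure ω f) := by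
  have h0 : 0 ≤ ∫ y, |φ y| ∂(absMeasure ω f) := integral_nonneg fun y => abs_nonneg _
  rw [← ENNReal.ofReal_le_ofReal_iff h0, ofReal_norm,
    ofReal_integral_absMeasure hf hφ.abs fun y => abs_nonneg _]
  refine (enorm_integral_le_lintegral_enorm _).trans (lintegral_mono fun y => ?_)
  rw [enorm_mul, ← ofReal_norm (φ y : ℂ), Complex.norm_real, Real.norm_eq_abs]

theorem pairing_sub (hf : LocallyIntegrable f ω) {φ ψ : K → ℝ} (hφ : IsTest φ)
    (hψ : IsTest ψ) :
    pairing ω f φ - pairing ω f ψ = pairing ω f fun y => φ y - ψ y := by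
  unfold pairing
  rw [← integral_sub (integrable_mul_test hf hφ) (integrable_mul_test hf hψ)]
  simp only [Complex.ofReal_sub, mul_sub]

end Density

/-! ### Uniform bounds for translates, from the amalgam condition. -/

section TranslateBound

variable {K : Type*} [TopologicalSpace K] [T2Space K] [LocallyCompactSpace K]
  [MeasurableSpace K] [BorelSpace K] [Hypergroup K] {ω η : Measure K}

theorem TranslateBound.of_le [IsFiniteMeasureOnCompacts η] {φ ψ : K → ℝ} (hφ : IsTest φ)
    (hψ : IsTest ψ) {c C : ℝ} (h : ∀ z, |φ z| ≤ c * |ψ z|) (hc : 0 ≤ c)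
    (hb : TranslateBound η ψ C) : TranslateBound η φ (c * C) := by
  intro x
  calc ∫ y, evalMul (fun z => |φ z|) x y ∂η
      ≤ ∫ y, c * evalMul (fun z => |ψ z|) x y ∂η := by
        refine integral_mono ((hφ.abs.evalMul_right x).integrable η)
          (((hψ.abs.evalMul_right x).integrable η).const_mul _) fun y => ?_
        simp only
        rw [← evalMul_const_mul]
        exact evalMul_mono hφ.abs.1 (continuous_const.mul hψ.abs.1) fun z _ => h z
    _ ≤ c * C := by
        rw [integral_const_mul]
        exact mul_le_mul_of_nonneg_left (hb x) hc

theorem TranslateBound.add [IsFiniteMeasureOnCompacts η] {φ ψ : K → ℝ} (hφ : IsTest φ)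
    (hψ : IsTest ψ) {C D : ℝ} (hb : TranslateBound η φ C) (hb' : TranslateBound η ψ D) :
    TranslateBound η (fun z => φ z + ψ z) (C + D) := by
  intro x
  have i1 := (hφ.abs.evalMul_right x).integrable η
  have i2 := (hψ.abs.evalMul_right x).integrable η
  calc ∫ y, evalMul (fun z => |φ z + ψ z|) x y ∂η
      ≤ ∫ y, (evalMul (fun z => |φ z|) x y + evalMul (fun z => |ψ z|) x y) ∂η := by
        refine integral_mono (((hφ.add hψ).abs.evalMul_right x).integrable η)
          (i1.add i2) fun y => ?_
        have : evalMul (fun z => |φ z|) x y + evalMul (fun z => |ψ z|) x y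
            = evalMul (fun z => |φ z| + |ψ z|) x y :=
          (integral_add (integrable_conv hφ.abs.1 x y) (integrable_conv hψ.abs.1 x y)).symm
        simp only [this]
        exact evalMul_mono (hφ.add hψ).abs.1 (hφ.abs.1.add hψ.abs.1) fun z _ => abs_add_le _ _
    _ ≤ C + D := by
        rw [integral_add i1 i2]
        exact add_le_add (hb x) (hb' x)

theorem TranslateBound.translate [IsFiniteMeasureOnCompacts η] {φ : K → ℝ} (hφ : IsTest φ)
    {C : ℝ} (hb : TranslateBound η φ C) (a : K) :
    TranslateBound η (fun y => evalMul φ a y) C := by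
  intro x
  have hc := hφ.abs.1
  have c2 := continuous_integral_evalMul_right η hφ.abs
  obtain ⟨D, hD, hD'⟩ := exists_isCompact_evalMul_right hφ.abs (isCompact_supp a x)
  calc ∫ y, evalMul (fun z => |evalMul φ a z|) x y ∂η
      ≤ ∫ y, evalMul (fun t => evalMul (fun z => |φ z|) t y) a x ∂η := by
        simp_rw [evalMul_assoc hc]
        refine integral_mono (((hφ.evalMul_right a).abs.evalMul_right x).integrable η)
          (((hφ.abs.evalMul_right a).evalMul_right x).integrable η) fun y => ?_
        exact evalMul_mono (hφ.evalMul_right a).abs.1 (hφ.abs.evalMul_right a).1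
          fun z _ => abs_evalMul_le φ a z
    _ = evalMul (fun t => ∫ y, evalMul (fun z => |φ z|) t y ∂η) a x :=
        (evalMul_integral η (F := fun t y => evalMul (fun z => |φ z|) t y)
          (by fun_prop) hD hD').symm
    _ ≤ C := by
        rw [← evalMul_const C a x]
        exact evalMul_mono c2 continuous_const fun t _ => hb t

/-- A bound for one test function that does not vanish at `e` gives bounds for all of them. -/
theorem exists_translateBound_of_pos [IsFiniteMeasureOnCompacts η] {v : K → ℝ} (hv : IsTest v)
    (h0 : ∀ z, 0 ≤ v z) (he : 0 < v e) {C : ℝ} (hb : TranslateBound η v C) {h : K → ℝ}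
    (hh : IsTest h) : ∃ D, TranslateBound η h D := by
  have key : ∃ u, IsTest u ∧ (∀ z, 0 ≤ u z) ∧ (∀ z ∈ tsupport h, 1 ≤ u z) ∧
      ∃ D, TranslateBound η u D := by
    refine hh.2.isCompact.induction_on (p := fun S => ∃ u, IsTest u ∧ (∀ z, 0 ≤ u z) ∧
      (∀ z ∈ S, 1 ≤ u z) ∧ ∃ D, TranslateBound η u D) ?_ ?_ ?_ ?_
    · exact ⟨v, hv, h0, by simp, C, hb⟩
    · rintro s t hst ⟨u, h1, h2, h3, h4⟩
      exact ⟨u, h1, h2, fun z hz => h3 z (hst hz), h4⟩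
    · rintro s t ⟨u, h1, h2, h3, D, h4⟩ ⟨u', h1', h2', h3', D', h4'⟩
      refine ⟨fun z => u z + u' z, h1.add h1', fun z => add_nonneg (h2 z) (h2' z), ?_, _,
        h4.add h1 h1' h4'⟩
      rintro z (hz | hz)
      · linarith [h3 z hz, h2' z]
      · linarith [h3' z hz, h2 z]
    · intro a _
      have hT := hv.evalMul_right (inv a)
      have hn : ∀ z, 0 ≤ evalMul v (inv a) z := fun z => evalMul_nonneg fun w _ => h0 w
      have hpos : 0 < evalMul v (inv a) a :=
        evalMul_pos hv.1 h0 ((e_mem_support_conv_iff _ _).2 rfl : e ∈ supp (inv a) a) he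
      -- The translate of `v` by `a⁻` is positive at `a`, because `e ∈ supp (inv a) a`. Divided by
      -- half its value there, it exceeds `1` near `a`; finitely many such functions dominate the
      -- indicator of `tsupport h`.
      set c := evalMul v (inv a) a / 2 with hc
      have hc0 : 0 < c := half_pos hpos
      refine ⟨{z | c < evalMul v (inv a) z}, mem_nhdsWithin_of_mem_nhds
        ((isOpen_lt continuous_const hT.1).mem_nhds (half_lt_self hpos)),
        fun z => c⁻¹ * evalMul v (inv a) z, hT.mul_left continuous_const,
        fun z => mul_nonneg (inv_nonneg.2 hc0.le) (hn z), fun z hz => ?_, c⁻¹ * C, ?_⟩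
      · exact (le_inv_mul_iff₀ hc0).2 (by rw [mul_one]; exact le_of_lt hz)
      · refine TranslateBound.of_le (hT.mul_left continuous_const) hT (fun z => ?_)
          (inv_nonneg.2 hc0.le) (hb.translate hv (inv a))
        rw [abs_mul, abs_of_pos (inv_pos.2 hc0)]
  obtain ⟨u, hu, hu0, hu1, D, hD⟩ := key
  obtain ⟨B, hB⟩ := hh.2.exists_bound_of_continuous hh.1
  refine ⟨|B| * D, TranslateBound.of_le hh hu (fun z => ?_) (abs_nonneg B) hD⟩
  by_cases hz : z ∈ tsupport h
  · calc |h z| ≤ |B| * 1 := by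
          rw [mul_one]
          exact (hB z).trans (le_abs_self B)
      _ ≤ |B| * |u z| := by
          gcongr
          exact (hu1 z hz).trans (le_abs_self _)
  · rw [IsTest.eq_zero hz, abs_zero]
    positivity

theorem MemAmalgam.exists_translateBound {f : K → ℂ} (hf : MemAmalgam ω f)
    (hfl : LocallyIntegrable f ω) {h : K → ℝ} (hh : IsTest h) :
    ∃ D, TranslateBound (absMeasure ω f) h D := by
  have := isFiniteMeasureOnCompacts_absMeasure hfl
  obtain ⟨-, V, hV, -, hVm, hfin⟩ := hf
  obtain ⟨v, vc, vs, v1, v0, vle, vV⟩ := exists_cutoff (isCompact_singleton (x := (e : K)))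
    isOpen_interior (singleton_subset_iff.2 (mem_interior_iff_mem_nhds.2 hV))
  have hv : IsTest v := ⟨vc, vs⟩
  refine exists_translateBound_of_pos (C := (amalgamNorm ω V f).toReal) hv v0
    (by rw [v1 e rfl]; exact one_pos) (fun x => ?_) hh
  simp_rw [abs_of_nonneg (v0 _)]
  have hle : ∀ y, evalMul v x y ≤ Hypergroup.translate x (ind V) y := by
    intro y
    refine integral_mono (integrable_conv vc x y) ((integrable_const (1 : ℝ)).indicator hVm)
      fun z => ?_
    by_cases hz : z ∈ V
    · simpa [ind, hz] using vle z
    · have : v z = 0 := IsTest.eq_zero fun h => hz (interior_subset (vV h))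
      simp [ind, hz, this]
  have hn : ∀ y, 0 ≤ evalMul v x y := fun y => evalMul_nonneg fun z _ => v0 z
  refine (ENNReal.ofReal_le_iff_le_toReal hfin.ne).1 ?_
  rw [ofReal_integral_absMeasure hfl (hv.evalMul_right x) hn]
  refine le_trans ?_ (le_iSup _ x)
  rw [eLpNorm_one_eq_lintegral_enorm]
  refine lintegral_mono fun y => ?_
  rw [enorm_mul, ← ofReal_norm (Complex.ofReal _), Complex.norm_real, Real.norm_eq_abs]
  gcongr
  exact (hle y).trans (le_abs_self _)

end TranslateBound

/-! ### Two numerical inequalities: Cauchy–Schwarz and extraction of `2^n`-th roots. -/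

theorem sq_norm_le_of_forall_nonneg {a b p q : ℂ} (hb : 0 ≤ b)
    (h : ∀ c : ℂ, 0 ≤ a + star c * p + c * q + c * star c * b) :
    ‖p‖ ^ 2 ≤ a.re * b.re := by
  have ha : 0 ≤ a := by simpa using h 0
  have h1 := h 1
  have h3 := h Complex.I
  rw [Complex.le_def] at ha hb h1 h3
  -- Nonnegativity in `ℂ` includes being real; `c = 1` and `c = I` therefore force Hermitian
  -- symmetry.
  have hq : q = star p := by
    apply Complex.ext
    · have := h3.2
      simp at this ha hb ⊢
      linarith
    · have := h1.2
      simp at this ha hb ⊢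
      linarith
  subst hq
  have hn : p.re ^ 2 + p.im ^ 2 = ‖p‖ ^ 2 := by
    rw [← Complex.normSq_eq_norm_sq, Complex.normSq_apply]
    ring
  -- The choice `c = t * p` gives a real quadratic in `t`, whose discriminant is then nonpositive.
  have key : ∀ t : ℝ, 0 ≤ (‖p‖ ^ 2 * b.re) * (t * t) + (2 * ‖p‖ ^ 2) * t + a.re := by
    intro t
    have := (Complex.le_def.1 (h (t * p))).1
    simp at this hb
    rw [← hn]
    rw [← hb.2] at this
    nlinarith
  have hd := discrim_le_zero key
  rw [discrim] at hd
  rcases (sq_nonneg ‖p‖).eq_or_lt with h0 | h0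
  · rw [← h0]
    exact mul_nonneg ha.1 hb.1
  · nlinarith

theorem le_mul_of_forall_pow_two_pow_le {a b C : ℝ} (hb : 0 < b)
    (h : ∀ n : ℕ, a ^ 2 ^ n ≤ C * b ^ 2 ^ n) : a ≤ b := by
  by_contra! hab
  have hq : 1 < a / b := (one_lt_div hb).2 hab
  obtain ⟨n, hn⟩ := pow_unbounded_of_one_lt C hq
  have h1 : (a / b) ^ n ≤ (a / b) ^ 2 ^ n := pow_le_pow_right₀ hq.le Nat.lt_two_pow_self.le
  have h2 : (a / b) ^ 2 ^ n ≤ C := by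
    rw [div_pow, div_le_iff₀ (by positivity)]
    exact h n
  linarith

/-! ### From bounds on test functions to essential bounds, and back. -/

section Local

variable {K : Type*} [TopologicalSpace K] [T2Space K] [LocallyCompactSpace K]
  [MeasurableSpace K] [BorelSpace K] {ω : Measure K} {f : K → ℂ}

/-- Regularity squeezes `E` between a compact and an open set, and a cutoff between them replaces
the indicator. Absolute continuity of the integral of `|f|` controls the error. -/
theorem norm_setIntegral_le_of_forall_pairing_le [ω.Regular] (hf : LocallyIntegrable f ω)
    {M : ℝ} (hM : 0 ≤ M) (h : ∀ φ : K → ℝ, IsTest φ → ‖pairing ω f φ‖ ≤ M * ∫ y, |φ y| ∂ω)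
    {E C : Set K} (hE : MeasurableSet E) (hC : IsCompact C) (hEC : E ⊆ C) :
    ‖∫ y in E, f y ∂ω‖ ≤ M * ω.real E := by
  obtain ⟨L, hL, hCL⟩ := exists_compact_superset hC
  have hEfin : ω E ≠ ∞ := ((measure_mono hEC).trans_lt hC.measure_lt_top).ne
  refine le_of_forall_pos_le_add fun ε hε => ?_
  -- The error enters once directly and once with factor `M`, and `ε' + M * ε' = ε`.
  set ε' := ε / (M + 1) with hε'
  have hε'0 : 0 < ε' := by positivity
  obtain ⟨δ, hδ, hδ'⟩ := exists_pos_setLIntegral_lt_of_measure_lt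
    (μ := ω.restrict L) (f := fun y => ‖f y‖ₑ) (hf.integrableOn_isCompact hL).2.ne
    (ENNReal.ofReal_pos.2 hε'0).ne'
  have hm : min (δ / 2) (ENNReal.ofReal ε') ≠ 0 :=
    (lt_min (ENNReal.half_pos hδ.ne') (ENNReal.ofReal_pos.2 hε'0)).ne'
  obtain ⟨O, hEO, hO, hOfin, hOE⟩ := hE.exists_isOpen_sdiff_lt hEfin hm
  obtain ⟨Q, hQE, hQ, hEQ⟩ := hE.exists_isCompact_sdiff_lt hEfin hm
  obtain ⟨χ, χc, χs, χ1, χ0, χle, χO⟩ := exists_cutoff hQ (hO.inter isOpen_interior)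
    (fun z hz => ⟨hEO (hQE hz), hCL (hEC (hQE hz))⟩)
  have hχ : IsTest χ := ⟨χc, χs⟩
  set D := (O ∩ interior L) \ Q
  have hDm : MeasurableSet D := (hO.inter isOpen_interior).measurableSet.diff hQ.measurableSet
  have hDL : D ⊆ L := fun z hz => interior_subset hz.1.2
  have hDsmall : ∫⁻ y in D, ‖f y‖ₑ ∂ω < ENNReal.ofReal ε' := by
    have h1 : (ω.restrict L) D < δ := by
      refine (Measure.restrict_apply_le _ _).trans_lt ?_
      have : D ⊆ (O \ E) ∪ (E \ Q) := by
        rintro z ⟨⟨hz, -⟩, hz'⟩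
        by_cases hzE : z ∈ E
        · exact Or.inr ⟨hzE, hz'⟩
        · exact Or.inl ⟨hz, hzE⟩
      refine ((measure_mono this).trans (measure_union_le _ _)).trans_lt ?_
      rw [← ENNReal.add_halves δ]
      exact ENNReal.add_lt_add (hOE.trans_le (min_le_left _ _)) (hEQ.trans_le (min_le_left _ _))
    have := hδ' D h1
    rwa [Measure.restrict_restrict hDm, inter_eq_left.2 hDL] at this
  have hdiff : ‖∫ y in E, f y ∂ω - pairing ω f χ‖ ≤ ε' := by
    rw [← integral_indicator hE, pairing, ← integral_sub
      ((integrable_indicator_iff hE).2 ((hf.integrableOn_isCompact hC).mono_set hEC))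
      (integrable_mul_test hf hχ)]
    rw [← ENNReal.ofReal_le_ofReal_iff hε'0.le, ofReal_norm]
    refine (enorm_integral_le_lintegral_enorm _).trans (le_trans ?_ hDsmall.le)
    rw [← lintegral_indicator hDm]
    refine lintegral_mono fun z => ?_
    by_cases hzQ : z ∈ Q
    · simp [χ1 z hzQ, hQE hzQ]
    · by_cases hzO : z ∈ O ∩ interior L
      · have hzD : z ∈ D := ⟨hzO, hzQ⟩
        rw [indicator_of_mem hzD]
        by_cases hzE : z ∈ E
        · rw [indicator_of_mem hzE, ← mul_one_sub, enorm_mul]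
          have : ‖(1 - (χ z : ℂ))‖ₑ ≤ 1 := by
            rw [← ofReal_norm, ← Complex.ofReal_one, ← Complex.ofReal_sub, Complex.norm_real,
              Real.norm_eq_abs]
            refine ENNReal.ofReal_le_one.2 (abs_le.2 ⟨?_, ?_⟩) <;> linarith [χ0 z, χle z]
          exact mul_le_of_le_one_right' this
        · rw [indicator_of_notMem hzE, zero_sub, enorm_neg, enorm_mul]
          have : ‖(χ z : ℂ)‖ₑ ≤ 1 := by
            rw [← ofReal_norm, Complex.norm_real, Real.norm_eq_abs]
            refine ENNReal.ofReal_le_one.2 (abs_le.2 ⟨?_, ?_⟩) <;> linarith [χ0 z, χle z]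
          exact mul_le_of_le_one_right' this
      · have h1 : χ z = 0 := IsTest.eq_zero fun h => hzO (χO h)
        have h2 : z ∉ E := fun h => hzO ⟨hEO h, hCL (hEC h)⟩
        simp [h1, h2]
  have hχint : ∫ y, |χ y| ∂ω ≤ ω.real E + ε' := by
    calc ∫ y, |χ y| ∂ω ≤ ∫ y, O.indicator (fun _ => (1 : ℝ)) y ∂ω := by
          refine integral_mono (hχ.abs.integrable ω) ?_ fun z => ?_
          · exact (integrable_indicator_iff hO.measurableSet).2 (integrableOn_const hOfin.ne)
          · by_cases hz : z ∈ O
            · simp only [indicator_of_mem hz, abs_of_nonneg (χ0 z)]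
              exact χle z
            · have h1 : χ z = 0 := IsTest.eq_zero fun h => hz (χO h).1
              simp [h1, hz]
      _ = ω.real O := by simp [integral_indicator hO.measurableSet]
      _ ≤ ω.real E + ω.real (O \ E) := by
          have : O = E ∪ (O \ E) := (union_sdiff_cancel hEO).symm
          conv_lhs => rw [this]
          exact measureReal_union_le _ _
      _ ≤ ω.real E + ε' := by
          gcongr
          exact ENNReal.toReal_le_of_le_ofReal hε'0.le (hOE.le.trans (min_le_right _ _))
  calc ‖∫ y in E, f y ∂ω‖ ≤ ‖∫ y in E, f y ∂ω - pairing ω f χ‖ + ‖pairing ω f χ‖ := by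
        simpa using norm_add_le (∫ y in E, f y ∂ω - pairing ω f χ) (pairing ω f χ)
    _ ≤ ε' + M * (ω.real E + ε') := by
        gcongr
        exact (h χ hχ).trans (mul_le_mul_of_nonneg_left hχint hM)
    _ = M * ω.real E + ε := by
        rw [hε']
        field_simp
        ring

theorem ae_norm_le_of_forall_pairing_le [ω.Regular] (hf : LocallyIntegrable f ω)
    {M : ℝ} (hM : 0 ≤ M) (h : ∀ φ : K → ℝ, IsTest φ → ‖pairing ω f φ‖ ≤ M * ∫ y, |φ y| ∂ω)
    {C : Set K} (hC : IsCompact C) : ∀ᵐ y ∂(ω.restrict C), ‖f y‖ ≤ M := by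
  have hfC : Integrable f (ω.restrict C) := hf.integrableOn_isCompact hC
  have : IsFiniteMeasure (ω.restrict C) := ⟨by simpa using hC.measure_lt_top⟩
  -- The real parts of `c * f` for countably many dense `c` determine `|f|`; the final choice is `c
  -- = star (f y)`.
  have key : ∀ c : ℂ, ∀ᵐ y ∂(ω.restrict C), (c * f y).re ≤ ‖c‖ * M := by
    intro c
    refine ae_le_of_forall_setIntegral_le (hfC.const_mul c).re (integrable_const _)
      fun s hs _ => ?_
    have h1 : ∫ y in s, (c * f y).re ∂(ω.restrict C)
        = (c * ∫ y in s ∩ C, f y ∂ω).re := by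
      rw [Measure.restrict_restrict hs, ← integral_const_mul]
      exact integral_re ((hfC.const_mul c).mono_measure (Measure.restrict_mono_set _
        inter_subset_right))
    have h2 : ∫ y in s, ‖c‖ * M ∂(ω.restrict C) = ‖c‖ * M * ω.real (s ∩ C) := by
      simp [Measure.restrict_restrict hs, mul_comm]
    refine h1.le.trans (le_trans ?_ h2.ge)
    refine (Complex.re_le_norm _).trans ?_
    rw [norm_mul, mul_assoc]
    gcongr
    exact norm_setIntegral_le_of_forall_pairing_le hf hM h (hs.inter hC.measurableSet) hC
      inter_subset_right
  have := ae_all_iff.2 fun n => key (TopologicalSpace.denseSeq ℂ n)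
  filter_upwards [this] with y hy
  have hall : ∀ c : ℂ, (c * f y).re ≤ ‖c‖ * M := fun c =>
    (TopologicalSpace.denseRange_denseSeq ℂ).induction_on
      (p := fun c => (c * f y).re ≤ ‖c‖ * M) c
      (isClosed_le (by fun_prop) (by fun_prop)) hy
  have h1 := hall (star (f y))
  rcases (norm_nonneg (f y)).eq_or_lt with h0 | h0
  · rwa [← h0]
  · have h2 : (star (f y) * f y).re = ‖f y‖ * ‖f y‖ := by
      rw [← sq, ← Complex.normSq_eq_norm_sq, Complex.normSq_apply]
      simp
    rw [h2, norm_star] at h1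
    exact le_of_mul_le_mul_left h1 h0

theorem norm_pairing_le_of_supNorm_le {U : Set K} {M : ℝ}
    (hM : supNorm ω (U.indicator f) ≤ ENNReal.ofReal M) (hM0 : 0 ≤ M) [IsFiniteMeasureOnCompacts ω]
    {φ : K → ℝ} (hφ : IsTest φ) (hU : ∀ z, φ z ≠ 0 → z ∈ U) :
    ‖pairing ω f φ‖ ≤ M * ∫ y, |φ y| ∂ω := by
  have hC : IsCompact (tsupport φ) := hφ.2
  have h1 : eLpNorm (U.indicator f) ∞ (ω.restrict (tsupport φ)) ≤ ENNReal.ofReal M :=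
    (le_iSup₂ (f := fun (C : Set K) (_ : IsCompact C) =>
      eLpNorm (U.indicator f) ∞ (ω.restrict C)) _ hC).trans hM
  rw [eLpNorm_exponent_top] at h1
  have h2 : ∀ᵐ y ∂ω, y ∈ tsupport φ → ‖U.indicator f y‖ₑ ≤ ENNReal.ofReal M := by
    rw [← ae_restrict_iff' hC.measurableSet]
    filter_upwards [ae_le_eLpNormEssSup (f := U.indicator f) (μ := ω.restrict (tsupport φ))]
      with y hy
    exact hy.trans h1
  rw [← integral_const_mul]
  refine norm_integral_le_of_norm_le ((hφ.abs.integrable ω).const_mul M) ?_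
  filter_upwards [h2] with y hy
  rw [norm_mul, Complex.norm_real, Real.norm_eq_abs]
  by_cases hy0 : φ y = 0
  · simp [hy0]
  · have := hy (subset_tsupport _ hy0)
    rw [indicator_of_mem (hU y hy0), ← ofReal_norm, ENNReal.ofReal_le_ofReal_iff hM0] at this
    gcongr

end Local

theorem integral_add_four {α : Type*} [MeasurableSpace α] {μ : Measure α} {p q r s : α → ℂ}
    (hp : Integrable p μ) (hq : Integrable q μ) (hr : Integrable r μ) (hs : Integrable s μ)
    {a b c : ℂ} :
    ∫ x, (p x + a * q x + b * r x + c * s x) ∂μ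
      = ∫ x, p x ∂μ + a * ∫ x, q x ∂μ + b * ∫ x, r x ∂μ + c * ∫ x, s x ∂μ := by
  have h1 := integral_add (hp.add (hq.const_mul a)) (hr.const_mul b)
  have h2 := integral_add ((hp.add (hq.const_mul a)).add (hr.const_mul b)) (hs.const_mul c)
  simp only [Pi.add_apply] at h1 h2
  rw [h2, h1, integral_add hp (hq.const_mul a), integral_const_mul, integral_const_mul,
    integral_const_mul]

/-! ### Functions of positive type: Cauchy–Schwarz, iteration, and the supremum bound. -/

section PositiveType

variable {K : Type*} [TopologicalSpace K] [T2Space K] [LocallyCompactSpace K]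
  [MeasurableSpace K] [BorelSpace K] [Hypergroup K] {ω : Measure K} {f : K → ℂ}

theorem evalMul_ofReal_add_mul {a b : K → ℝ} (ha : Continuous a) (hb : Continuous b) (c : ℂ)
    (x y : K) :
    evalMul (fun z => (a z : ℂ) + c * (b z : ℂ)) x y
      = ((evalMul a x y : ℝ) : ℂ) + c * ((evalMul b x y : ℝ) : ℂ) := by
  have h1 : Integrable (fun z => (a z : ℂ)) (conv x y : Measure K) :=
    (integrable_conv ha x y).ofReal
  have h2 : Integrable (fun z => (b z : ℂ)) (conv x y : Measure K) :=
    (integrable_conv hb x y).ofReal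
  unfold evalMul
  rw [← integral_complex_ofReal, ← integral_complex_ofReal, ← integral_const_mul]
  exact integral_add h1 (h2.const_mul c)

theorem convFun_adj_ofReal_add_mul (hω : IsLeftHaar ω) {a b : K → ℝ} (ha : IsTest a)
    (hb : IsTest b) (c : ℂ) (x : K) :
    convFun ω (fun z => (a z : ℂ) + c * (b z : ℂ)) (adj ω fun z => (a z : ℂ) + c * (b z : ℂ)) x
      = (corr ω a a x : ℂ) + star c * (corr ω a b x : ℂ) + c * (corr ω b a x : ℂ)
        + c * star c * (corr ω b b x : ℂ) := by
  have := hω.isFiniteMeasureOnCompacts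
  have hint : ∀ {g h : K → ℝ}, IsTest g → IsTest h →
      Integrable (fun y => ((evalMul g x y * (h y * modular ω y) : ℝ) : ℂ)) ω := fun hg hh =>
    (((hh.mul_modular hω).mul_left
      (hg.1.evalMul continuous_const continuous_id)).integrable ω).ofReal
  unfold corr convFun adj
  simp_rw [evalMul_ofReal_add_mul ha.1 hb.1, inv_inv]
  simp_rw [← integral_complex_ofReal]
  rw [← integral_add_four (hint ha ha) (hint ha hb) (hint hb ha) (hint hb hb)]
  congr 1
  ext y
  simp only [Complex.ofReal_mul, star_add, star_mul', Complex.star_def, Complex.conj_ofReal]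
  ring

theorem IsPositiveType.nonneg_add_mul (hω : IsLeftHaar ω) (hf : IsPositiveType ω f)
    {a b : K → ℝ} (ha : IsTest a) (hb : IsTest b) (c : ℂ) :
    0 ≤ pairing ω f (corr ω a a) + star c * pairing ω f (corr ω a b)
      + c * pairing ω f (corr ω b a) + c * star c * pairing ω f (corr ω b b) := by
  have hac := ha.1
  have hbc := hb.1
  have hg : HasCompactSupport fun z => (a z : ℂ) + c * (b z : ℂ) :=
    (ha.2.comp_left Complex.ofReal_zero).add
      ((hb.2.comp_left Complex.ofReal_zero).mul_left (f := fun _ => c))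
  have h1 := hf.2 (fun z => (a z : ℂ) + c * (b z : ℂ)) (by fun_prop) hg
  simp_rw [convFun_adj_ofReal_add_mul hω ha hb] at h1
  have hint : ∀ {g h : K → ℝ}, IsTest g → IsTest h →
      Integrable (fun y => f y * (corr ω g h y : ℂ)) ω := fun hg hh =>
    integrable_mul_test hf.1 (hg.corr hω hh)
  refine h1.trans_eq ?_
  unfold pairing
  rw [← integral_add_four (hint ha ha) (hint ha hb) (hint hb ha) (hint hb hb)]
  congr 1
  ext y
  ring

theorem IsPositiveType.pairing_corr_nonneg (hω : IsLeftHaar ω) (hf : IsPositiveType ω f)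
    {a : K → ℝ} (ha : IsTest a) : 0 ≤ pairing ω f (corr ω a a) := by
  have h0 : IsTest fun _ : K => (0 : ℝ) :=
    .of_isCompact continuous_const isCompact_empty fun _ _ => rfl
  simpa using hf.nonneg_add_mul hω ha h0 0

theorem IsPositiveType.sq_norm_pairing_corr_le (hω : IsLeftHaar ω) (hf : IsPositiveType ω f)
    {a b : K → ℝ} (ha : IsTest a) (hb : IsTest b) :
    ‖pairing ω f (corr ω a b)‖ ^ 2
      ≤ ‖pairing ω f (corr ω a a)‖ * ‖pairing ω f (corr ω b b)‖ := by
  have h1 := hf.pairing_corr_nonneg hω ha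
  have h2 := hf.pairing_corr_nonneg hω hb
  refine (sq_norm_le_of_forall_nonneg h2 (hf.nonneg_add_mul hω ha hb)).trans ?_
  exact mul_le_mul (Complex.re_le_norm _) (Complex.re_le_norm _) (Complex.le_def.1 h2).1
    (norm_nonneg _)

/-- The function `k^*` for a bump function `k`. -/
theorem IsBump.isTest_mul_modular_inv (hω : IsLeftHaar ω) {W : Set K} {k : K → ℝ}
    (hk : IsBump ω W k) : IsTest fun y => k y * modular ω (inv y) :=
  hk.toIsTest.mul_right ((continuous_modular hω).comp continuous_inv)

/-- With `κ = k^*` one has `κ * κ^* = k^* * k`, which lives in `W * W ⊆ U` and has `L¹` norm at most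
`1`, since `∫ k^* = ∫ k = 1`. -/
theorem IsBump.norm_pairing_corr_le (hω : IsLeftHaar ω) {U W : Set K} {k : K → ℝ}
    (hk : IsBump ω W k) (hW : ∀ x ∈ W, ∀ y ∈ W, supp x y ⊆ U) {M : ℝ} (hM0 : 0 ≤ M)
    (hM : supNorm ω (U.indicator f) ≤ ENNReal.ofReal M) :
    ‖pairing ω f (corr ω (fun y => k y * modular ω (inv y))
      fun y => k y * modular ω (inv y))‖ ≤ M := by
  have := hω.isFiniteMeasureOnCompacts
  have hκ := hk.isTest_mul_modular_inv hω
  have hint : ∫ y, |k y * modular ω (inv y)| ∂ω = 1 := by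
    rw [← hk.integral_eq_one, ← integral_inv_mul_modular hω hk.toIsTest]
    congr 1
    ext y
    rw [hk.symm, abs_of_nonneg (mul_nonneg (hk.nonneg y) (modular_pos hω _).le)]
  have hsupp : ∀ x, corr ω (fun y => k y * modular ω (inv y))
      (fun y => k y * modular ω (inv y)) x ≠ 0 → x ∈ U := by
    intro x hx
    by_contra hxU
    refine hx ?_
    rw [corr, ← integral_zero K ℝ]
    congr 1
    ext y
    by_contra hne
    obtain ⟨z, hz, hz'⟩ := exists_mem_supp_of_evalMul_ne_zero (left_ne_zero_of_mul hne)
    have hy : k (inv y) ≠ 0 := by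
      rw [hk.symm]
      exact left_ne_zero_of_mul (left_ne_zero_of_mul (right_ne_zero_of_mul hne))
    exact hxU (hW z (hk.mem_of_ne_zero z (left_ne_zero_of_mul hz')) (inv y)
      (hk.mem_of_ne_zero _ hy) (mem_supp_left hz))
  refine (norm_pairing_le_of_supNorm_le hM hM0 (hκ.corr hω hκ) hsupp).trans ?_
  have := integral_abs_corr_le hω hκ hκ
  rw [hint, one_mul] at this
  exact mul_le_of_le_one_right hM0 this

/-- Here `(k^*)^* = k`, so the convolution averages `h (x * y)` over `y` near `e` with weight `k`.
-/
theorem IsBump.abs_corr_sub_le (hω : IsLeftHaar ω) {W : Set K} {h k : K → ℝ} (hh : IsTest h)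
    (hk : IsBump ω W k) {ε : ℝ}
    (hW : ∀ t, ∀ w ∈ W, ∀ y ∈ supp t w, |h y - h t| ≤ ε) (x : K) :
    |corr ω h (fun y => k y * modular ω (inv y)) x - h x| ≤ ε := by
  have := hω.isFiniteMeasureOnCompacts
  have hkT := hk.toIsTest
  have hc : Continuous fun y => evalMul h x y := (hh.evalMul_right x).1
  have e1 : corr ω h (fun y => k y * modular ω (inv y)) x = ∫ y, evalMul h x y * k y ∂ω := by
    unfold corr
    congr 1
    ext y
    linear_combination (evalMul h x y * k y) * modular_mul_modular_inv hω y
  have e2 : corr ω h (fun y => k y * modular ω (inv y)) x - h x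
      = ∫ y, (evalMul h x y - h x) * k y ∂ω := by
    simp_rw [sub_mul]
    rw [integral_sub ((hkT.mul_left hc).integrable ω) ((hkT.integrable ω).const_mul _),
      integral_const_mul, hk.integral_eq_one, mul_one, e1]
  rw [e2]
  calc |∫ y, (evalMul h x y - h x) * k y ∂ω|
      ≤ ∫ y, |(evalMul h x y - h x) * k y| ∂ω := abs_integral_le_integral_abs
    _ ≤ ∫ y, ε * k y ∂ω := by
        refine integral_mono ((hkT.mul_left (ψ := fun y => evalMul h x y - h x)
          (hc.sub continuous_const)).abs.integrable ω) ((hkT.integrable ω).const_mul _) fun y => ?_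
        simp only [abs_mul, abs_of_nonneg (hk.nonneg y)]
        by_cases hy : k y = 0
        · simp [hy]
        · exact mul_le_mul_of_nonneg_right (abs_evalMul_sub_le hh.1
            (hW x y (hk.mem_of_ne_zero y hy))) (hk.nonneg y)
    _ = ε := by rw [integral_const_mul, hk.integral_eq_one, mul_one]

theorem IsPositiveType.sq_norm_pairing_le (hω : IsLeftHaar ω) (hf : IsPositiveType ω f)
    {U : Set K} (hU : U ∈ 𝓝 (e : K)) {M : ℝ} (hM0 : 0 ≤ M)
    (hM : supNorm ω (U.indicator f) ≤ ENNReal.ofReal M) {h : K → ℝ} (hh : IsTest h) :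
    ‖pairing ω f h‖ ^ 2 ≤ M * ‖pairing ω f (corr ω h h)‖ := by
  have := isFiniteMeasureOnCompacts_absMeasure hf.1
  obtain ⟨V, hV, hVe⟩ := exists_compact_mem_nhds (e : K)
  -- `D` depends only on `h` and `V`, so `m` is fixed before `k` is chosen. A uniform error `δ / (m
  -- + 1)` on this set then changes the pairing by at most `δ`.
  obtain ⟨D, hD, hD'⟩ := exists_isCompact_corr (ω := ω) hh.2.isCompact hV
  have hDh := hD.union hh.2.isCompact
  set m := (absMeasure ω f).real (D ∪ tsupport h)
  have hm : 0 ≤ m := measureReal_nonneg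
  set s := √(M * ‖pairing ω f (corr ω h h)‖)
  suffices hs : ‖pairing ω f h‖ ≤ s by
    rw [← Real.sq_sqrt (show 0 ≤ M * ‖pairing ω f (corr ω h h)‖ by positivity)]
    gcongr
  refine le_of_forall_pos_le_add fun δ hδ => ?_
  obtain ⟨W, hW, hWh⟩ := hh.exists_nhds_right (ε := δ / (m + 1)) (by positivity)
  have hUe : ∀ᶠ p : K × K in 𝓝 (e : K) ×ˢ 𝓝 (e : K), supp p.1 p.2 ⊆ U := by
    have h1 := eventually_supp_subset (x := (e : K)) (y := e) (isOpen_interior (s := U))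
      (by rw [supp_e_left]; exact singleton_subset_iff.2 (mem_interior_iff_mem_nhds.2 hU))
    rw [nhds_prod_eq] at h1
    exact h1.mono fun p hp => hp.trans interior_subset
  obtain ⟨W', hW', hWU⟩ := (eventually_prod_self_iff (r := fun a b => supp a b ⊆ U)).1 hUe
  obtain ⟨k, hk⟩ := hω.exists_isBump (inter_mem hVe (inter_mem hW hW'))
  have hκ := hk.isTest_mul_modular_inv hω
  set κ : K → ℝ := fun y => k y * modular ω (inv y)
  have h1 : ‖pairing ω f (corr ω h κ)‖ ≤ s := by
    refine Real.le_sqrt_of_sq_le ((hf.sq_norm_pairing_corr_le hω hh hκ).trans ?_)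
    rw [mul_comm]
    exact mul_le_mul_of_nonneg_right (hk.norm_pairing_corr_le hω
      (fun x hx y hy => hWU x hx.2.2 y hy.2.2) hM0 hM) (norm_nonneg _)
  have h2 : ‖pairing ω f (corr ω h κ) - pairing ω f h‖ ≤ δ := by
    have hT := (hh.corr hω hκ).sub hh
    rw [pairing_sub hf.1 (hh.corr hω hκ) hh]
    refine (norm_pairing_le hf.1 hT).trans ?_
    have hle := hk.abs_corr_sub_le hω hh fun t w hw => hWh t w hw.2.1
    calc ∫ y, |corr ω h κ y - h y| ∂(absMeasure ω f)
        ≤ ∫ y, (D ∪ tsupport h).indicator (fun _ => δ / (m + 1)) y ∂(absMeasure ω f) := by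
          refine integral_mono (hT.abs.integrable _)
            ((integrable_indicator_iff hDh.measurableSet).2
              (integrableOn_const hDh.measure_ne_top)) fun y => ?_
          by_cases hy : y ∈ D ∪ tsupport h
          · rw [indicator_of_mem hy]
            exact hle y
          · rw [indicator_of_notMem hy]
            have hy1 : h y = 0 := IsTest.eq_zero fun h' => hy (Or.inr h')
            have hy2 : corr ω h κ y = 0 := by
              by_contra hne
              exact hy (Or.inl (hD' h κ (fun z => (subset_tsupport h ·))
                (fun z hz => (hk.mem_of_ne_zero z (left_ne_zero_of_mul hz)).1) y hne))
            simp [hy1, hy2]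
      _ = m * (δ / (m + 1)) := by
          rw [integral_indicator hDh.measurableSet, setIntegral_const, smul_eq_mul]
      _ ≤ δ := by
          rw [mul_div_assoc', div_le_iff₀ (by positivity)]
          nlinarith
  calc ‖pairing ω f h‖
      ≤ ‖pairing ω f (corr ω h κ)‖ + ‖pairing ω f (corr ω h κ) - pairing ω f h‖ := by
        rw [norm_sub_rev, add_comm]
        exact norm_le_norm_sub_add _ _
    _ ≤ s + δ := add_le_add h1 h2

theorem TranslateBound.norm_pairing_le (hf : LocallyIntegrable f ω) {h : K → ℝ} (hh : IsTest h)
    {C : ℝ} (hb : TranslateBound (absMeasure ω f) h C) : ‖pairing ω f h‖ ≤ C := by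
  refine (Hypergroup.norm_pairing_le hf hh).trans ?_
  simpa only [evalMul_e_left] using hb e

/-- The factor `M` on the left avoids the exponent `2 ^ n - 1`. In the induction `h`, `r`, `C`
become `h * h^*`, `r ^ 2`, `r * C`, and `C / r` does not change. -/
theorem pow_two_pow_norm_pairing_le (hω : IsLeftHaar ω) (hf : LocallyIntegrable f ω) {M : ℝ}
    (hM0 : 0 ≤ M)
    (hM : ∀ h : K → ℝ, IsTest h → ‖pairing ω f h‖ ^ 2 ≤ M * ‖pairing ω f (corr ω h h)‖)
    {r : ℝ} (hr : 0 < r) (n : ℕ) :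
    ∀ {h : K → ℝ} {C : ℝ}, IsTest h → IsSelfAdj ω h → ∫ y, |h y| ∂ω ≤ r →
      TranslateBound (absMeasure ω f) h C →
      ‖pairing ω f h‖ ^ 2 ^ n * M ≤ C / r * (M * r) ^ 2 ^ n := by
  have := hω.isFiniteMeasureOnCompacts
  have := isFiniteMeasureOnCompacts_absMeasure hf
  induction n generalizing r with
  | zero =>
    intro h C hh _ _ hb
    have := hb.norm_pairing_le hf hh
    have e : C / r * (M * r) ^ 2 ^ 0 = C * M := by
      rw [pow_zero, pow_one]
      field_simp
    rw [e, pow_zero, pow_one]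
    gcongr
  | succ n ih =>
    intro h C hh hs hint hb
    have hC : 0 ≤ C := (norm_nonneg _).trans (hb.norm_pairing_le hf hh)
    have hI : 0 ≤ ∫ y, |h y| ∂ω := integral_nonneg fun y => abs_nonneg _
    have h1 : ∫ y, |corr ω h h y| ∂ω ≤ r ^ 2 := by
      refine (integral_abs_corr_le hω hh hh).trans ?_
      rw [sq]
      gcongr
    have h2 : TranslateBound (absMeasure ω f) (corr ω h h) (r * C) := fun x =>
      (hb.corr hω hh hh hs x).trans (by gcongr)
    have h3 := ih (r := r ^ 2) (by positivity) (hh.corr hω hh) (isSelfAdj_corr hω hh) h1 h2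
    calc ‖pairing ω f h‖ ^ 2 ^ (n + 1) * M = (‖pairing ω f h‖ ^ 2) ^ 2 ^ n * M := by
          rw [← pow_mul, ← pow_succ']
      _ ≤ (M * ‖pairing ω f (corr ω h h)‖) ^ 2 ^ n * M := by
          gcongr
          exact hM h hh
      _ = M ^ 2 ^ n * (‖pairing ω f (corr ω h h)‖ ^ 2 ^ n * M) := by
          rw [mul_pow, mul_assoc]
      _ ≤ M ^ 2 ^ n * (r * C / r ^ 2 * (M * r ^ 2) ^ 2 ^ n) := by gcongr
      _ = C / r * (M * r) ^ 2 ^ (n + 1) := by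
          have e : r * C / r ^ 2 = C / r := by field_simp
          rw [e, pow_succ' 2 n, pow_mul (M * r), mul_pow M r 2, mul_pow (M ^ 2), mul_pow M,
            sq M, mul_pow M M]
          ring

theorem IsPositiveType.norm_pairing_le (hω : IsLeftHaar ω) (hf : IsPositiveType ω f)
    (hfa : MemAmalgam ω f) {U : Set K} (hU : U ∈ 𝓝 (e : K)) {M : ℝ} (hM0 : 0 < M)
    (hM : supNorm ω (U.indicator f) ≤ ENNReal.ofReal M) {h : K → ℝ} (hh : IsTest h) :
    ‖pairing ω f h‖ ≤ M * ∫ y, |h y| ∂ω := by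
  have key := fun (h : K → ℝ) (hh : IsTest h) => hf.sq_norm_pairing_le hω hU hM0.le hM hh
  have selfAdj : ∀ {h : K → ℝ} {r : ℝ}, IsTest h → IsSelfAdj ω h → 0 < r →
      ∫ y, |h y| ∂ω ≤ r → ‖pairing ω f h‖ ≤ M * r := by
    intro h r hh hs hr hint
    obtain ⟨C, hC⟩ := hfa.exists_translateBound hf.1 hh
    refine le_mul_of_forall_pow_two_pow_le (C := C / r / M) (mul_pos hM0 hr) fun n => ?_
    have := pow_two_pow_norm_pairing_le hω hf.1 hM0.le key hr n hh hs hint hC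
    rw [div_mul_eq_mul_div, le_div_iff₀ hM0]
    exact this
  have hI : 0 ≤ ∫ y, |h y| ∂ω := integral_nonneg fun y => abs_nonneg _
  -- A strict upper bound `r` stays positive even if `h` has integral norm `0`; `r` is let down to
  -- the norm at the end.
  have strict : ∀ r, ∫ y, |h y| ∂ω < r → ‖pairing ω f h‖ ≤ M * r := by
    intro r hr
    have hr0 : 0 < r := hI.trans_lt hr
    have h1 : ∫ y, |corr ω h h y| ∂ω ≤ r ^ 2 := by
      refine (integral_abs_corr_le hω hh hh).trans ?_
      rw [sq]
      gcongr
    have h2 := selfAdj (hh.corr hω hh) (isSelfAdj_corr hω hh) (by positivity) h1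
    refine le_of_sq_le_sq ?_ (by positivity)
    calc ‖pairing ω f h‖ ^ 2 ≤ M * ‖pairing ω f (corr ω h h)‖ := key h hh
      _ ≤ M * (M * r ^ 2) := by gcongr
      _ = (M * r) ^ 2 := by ring
  rw [mul_comm, ← div_le_iff₀ hM0]
  refine le_of_forall_gt_imp_ge_of_dense fun r hr => ?_
  rw [div_le_iff₀ hM0, mul_comm]
  exact strict r hr

/-- A function of positive type in the amalgam space attains its supremum norm near `e`. -/
theorem IsPositiveType.supNorm_le (hω : IsLeftHaar ω) (hf : IsPositiveType ω f)
    (hfa : MemAmalgam ω f) {U : Set K} (hU : U ∈ 𝓝 (e : K)) :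
    supNorm ω f ≤ supNorm ω (U.indicator f) := by
  have := hω.regular
  refine ENNReal.le_of_forall_pos_le_add fun ε hε hfin => ?_
  -- Adding `ε` makes the bound positive, as root extraction requires, even if `f` vanishes on `U`.
  have hM0 : 0 < (supNorm ω (U.indicator f)).toReal + ε := by positivity
  have hM : ENNReal.ofReal ((supNorm ω (U.indicator f)).toReal + ε)
      = supNorm ω (U.indicator f) + ε := by
    rw [ENNReal.ofReal_add ENNReal.toReal_nonneg ε.coe_nonneg, ENNReal.ofReal_toReal hfin.ne,
      ENNReal.ofReal_coe_nnreal]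
  rw [← hM]
  refine iSup₂_le fun C hC => ?_
  rw [eLpNorm_exponent_top]
  refine eLpNormEssSup_le_of_ae_bound ?_
  exact ae_norm_le_of_forall_pairing_le hf.1 hM0.le
    (fun φ hφ => hf.norm_pairing_le hω hfa hU hM0 (hM.symm ▸ le_self_add) hφ) hC

theorem supNorm_mono {g h : K → ℂ} (hgh : ∀ y, ‖g y‖ ≤ ‖h y‖) : supNorm ω g ≤ supNorm ω h :=
  iSup₂_mono fun _ _ => eLpNorm_mono hgh

end PositiveType

end Hypergroup

/-! ### The main theorem. -/

theorem mainTheorem3 {K : Type*} [TopologicalSpace K] [T2Space K] [LocallyCompactSpace K]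
    [MeasurableSpace K] [BorelSpace K] [Hypergroup K]
    (ω : MeasureTheory.Measure K) (hω : Hypergroup.IsLeftHaar ω)
    (f : K → ℂ) (hf : Hypergroup.MemAmalgam ω f) (hpos : Hypergroup.IsPositiveType ω f)
    (U : Set K) (hU : U ∈ nhds (Hypergroup.e : K)) (hUc : IsCompact (closure U)) :
    Hypergroup.supNorm ω f ≤ Hypergroup.supNorm ω (U.indicator f) ∧
      (MeasurableSet U → ∀ x : K,
        Hypergroup.supNorm ω
            (fun y => f y * ((Hypergroup.translate x (Hypergroup.ind U) y : ℝ) : ℂ)) ≤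
          Hypergroup.supNorm ω
            ({y | 0 < Hypergroup.translate x (Hypergroup.ind U) y}.indicator f) ∧
        Hypergroup.supNorm ω
            ({y | 0 < Hypergroup.translate x (Hypergroup.ind U) y}.indicator f) ≤
          Hypergroup.supNorm ω (U.indicator f)) := by
  have main := hpos.supNorm_le hω hf hU
  refine ⟨main, fun hUm x => ⟨Hypergroup.supNorm_mono fun y => ?_,
    (Hypergroup.supNorm_mono fun y => norm_indicator_le_norm_self f y).trans main⟩⟩
  have h0 : 0 ≤ Hypergroup.translate x (Hypergroup.ind U) y :=
    integral_nonneg fun z => indicator_nonneg (fun _ _ => zero_le_one) z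
  -- `ε_x * ε_y` is a probability measure; measurability of `U` makes its indicator integrable.
  have h1 : Hypergroup.translate x (Hypergroup.ind U) y ≤ 1 := by
    rw [← Hypergroup.evalMul_const 1 x y]
    exact integral_mono ((integrable_const (1 : ℝ)).indicator hUm) (integrable_const _)
      fun z => indicator_le_self' (fun _ _ => zero_le_one) z
  rw [norm_mul, Complex.norm_real, Real.norm_of_nonneg h0]
  by_cases hy : 0 < Hypergroup.translate x (Hypergroup.ind U) y
  · rw [indicator_of_mem (show y ∈ {y | 0 < Hypergroup.translate x (Hypergroup.ind U) y} from hy)]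
    exact mul_le_of_le_one_right (norm_nonneg _) h1
  · rw [le_antisymm (not_lt.1 hy) h0, mul_zero]
    exact norm_nonneg _
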